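/- **Theorem 1 (Detection, full sampling).** All logarithms are to base 2. Let $P_0,P_1$ be probability distributions on a finite alphabet $\mathcal Y$ with finite divergence $D(P_1\|P_0)=\sum_y P_1(y)\log\frac{P_1(y)}{P_0(y)}$ (that is, $P_0(y)=0$ implies $P_1(y)=0$). For $\alpha\ge 0$ and $n\in\mathbb N$ let $A_n=\lfloor 2^{\alpha n}\rfloor$, let $\nu_n$ be uniform on $\{1,\dots,A_n\}$ and, given $\nu_n$, let $Y_1,\dots,Y_{A_n+n-1}$ be independent, with $Y_t\sim P_1$ for $\nu_n\le t\le \nu_n+n-1$ and $Y_t\sim P_0$ otherwise. A detector $(\mathcal S,\tau)$ consists of a (possibly randomized) adaptive set of sampling times $\mathcal S\subseteq\{1,\dots,A_n+n-1\}$, each sampling time depending only on the previously sampled values and on randomness independent of $(\nu_n,Y)$, and of a (possibly randomized) stopping time $\tau\in\{1,\dots,A_n+n-1\}$ of the sampled process. For $\varepsilon\ge0$, its delay $d((\mathcal S,\tau),\varepsilon)$ is the least integer $l\ge0$ with $\mathbb P(\tau-\nu_n\le l-1)\ge 1-\varepsilon$, and its sampling rate $\rho((\mathcal S,\tau),\varepsilon)$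 is the least $r\ge 0$ with $\mathbb P(|\{S\in\mathcal S: S\le\tau\}|/\tau\le r)\ge 1-\varepsilon$. A sequence of detectors $(\mathcal S_n,\tau_n)$ with a sequence $\varepsilon_n\ge0$, $\varepsilon_n\to0$, achieves the sampling rates $(\rho_n)$ at uncertainty exponent $\alpha\ge 0$ if, for all large $n$, $(\mathcal S_n,\tau_n)$ operates under uncertainty level $A_n$, $\mathbb P(\tau_n<\nu_n)\le\varepsilon_n$, $\rho((\mathcal S_n,\tau_n),\varepsilon_n)\le\rho_n$, and the delay $d_n=d((\mathcal S_n,\tau_n),\varepsilon_n)$ satisfies $\frac1n\log d_n\le\varepsilon_n$. The exponent $\alpha$ is achievable under full sampling if some such pair of sequences achieves it with $\rho_n=1$ for all $n$. Put $n^*(\alpha)=n\alpha/D(P_1\|P_0)$. Then, under full sampling: 1. the supremum of the set of achievable uncertainty exponents is $D(P_1\|P_0)$; 2. for $\alpha\in(0,D(P_1\|P_0))$, every sequence of detectors that achieves $\alpha$ (with any admissible $\varepsilon_n\to0$) has delay satisfying $\liminf_{n\to\infty} d_n/n^*(\alpha)\ge 1$; 3. for $\alpha\in(0,D(P_1\|P_0))$,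 the exponent $\alpha$ is achieved with delay satisfying $\limsup_{n\to\infty} d_n/n^*(\alpha)\le 1$, by a sequential typicality test: for suitable window lengths $k_n$, the detector that samples at every time and stops at the first time at which the empirical distribution of the last $k_n$ observations is within $L^1$-distance $k_n^{-1/3}$ of $P_1$ (and at time $A_n+n-1$ if this never happens). -/

import Mathlib

open MeasureTheory Filter Topology

namespace TransientChange

/-- The relative entropy `D(P ‖ Q) = ∑ y, P(y) log₂ (P(y) / Q(y))` on a finite alphabet (the value is
meaningful when it is finite, that is, when `Q y = 0` implies `P y = 0`). -/
noncomputable def relEntropy {𝒴 : Type*} [Fintype 𝒴] (P Q : PMF 𝒴) : ℝ :=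
  ∑ y, (P y).toReal * Real.logb 2 ((P y).toReal / (Q y).toReal)

/-- The integer uncertainty level `Aₙ = 2^{αn}` (rounded down). -/
noncomputable def level (α : ℝ) (n : ℕ) : ℕ := ⌊(2 : ℝ) ^ (α * n)⌋₊

/-- The observation times `1, …, N`. -/
abbrev Times (N : ℕ) : Type := Finset.Icc 1 N

/-- A (randomized) detector `(S, τ)` for an observation horizon `1, …, N`. All its randomization comes
from a seed, which is drawn from an arbitrary probability space, independently of the observations.
Given the seed `ω` and the observations `y`, `sample ω y` is the set of sampling times, and
`stopTime ω y` is the time at which the change is declared. -/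
structure Detector (𝒴 : Type*) (N : ℕ) where
  /-- the space of seeds -/
  Seed : Type
  /-- its σ-algebra -/
  seedSpace : MeasurableSpace Seed
  /-- the law of the seed -/
  seedLaw : @Measure Seed seedSpace
  /-- which is a probability measure -/
  seedLaw_prob : @IsProbabilityMeasure Seed seedSpace seedLaw
  /-- the sampling strategy -/
  sample : Seed → (Times N → 𝒴) → Finset (Times N)
  /-- the stopping rule -/
  stopTime : Seed → (Times N → 𝒴) → ℕ
  /-- the sampling times are measurable in the seed -/
  measurable_sample : ∀ y F, @MeasurableSet Seed seedSpace {ω | sample ω y = F}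
  /-- the stopping time is measurable in the seed -/
  measurable_stop : ∀ y t, @MeasurableSet Seed seedSpace {ω | stopTime ω y = t}
  /-- sampling is adaptive: whether time `t` is sampled is decided from the seed and from the
  values sampled before time `t` -/
  adaptive : ∀ ω y y' (t : Times N), (∀ s ∈ sample ω y, s < t → y s = y' s) →
    (t ∈ sample ω y ↔ t ∈ sample ω y')
  /-- the stopping rule is a (randomized) stopping time of the sampled process: whether to stop at
  time `t` is decided from the seed and from the values sampled up to time `t` -/
  nonanticipating : ∀ ω y y',
    (∀ s ∈ sample ω y, (s : ℕ) ≤ stopTime ω y → y s = y' s) → stopTime ω y' = stopTime ω y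
  /-- the stopping time is positive (on a nonempty horizon) -/
  stop_pos : 0 < N → ∀ ω y, 1 ≤ stopTime ω y
  /-- the stopping time is at most `N` -/
  stop_le : ∀ ω y, stopTime ω y ≤ N

attribute [instance] Detector.seedSpace Detector.seedLaw_prob

/-- The number `|S^{≤ τ}|` of samples taken up to the stopping time. -/
def Detector.numSamples {𝒴 : Type*} {N : ℕ} (D : Detector 𝒴 N) (ω : D.Seed)
    (y : Times N → 𝒴) : ℕ :=
  ((D.sample ω y).filter fun s : Times N => (s : ℕ) ≤ D.stopTime ω y).card

section Model

variable {𝒴 : Type*} [MeasurableSpace 𝒴]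

/-- The law of the observations `Y_1, …, Y_N` given that the change starts at time `ν`: they are
independent, with law `P₁` at the times `ν, …, ν + n - 1` and with law `P₀` at all other times. -/
noncomputable def obsLaw (P₀ P₁ : PMF 𝒴) (n ν N : ℕ) : Measure (Times N → 𝒴) :=
  Measure.pi fun t => (if ν ≤ (t : ℕ) ∧ (t : ℕ) < ν + n then P₁ else P₀).toMeasure

/-- The joint law of the change point `ν`, uniform on `{1, …, A}`, of the observations
`Y_1, …, Y_{A + n - 1}`, and of the seed of the detector (independent of the two others). -/
noncomputable def jointLaw (P₀ P₁ : PMF 𝒴) (A n : ℕ) (D : Detector 𝒴 (A + n - 1)) :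
    Measure (ℕ × (Times (A + n - 1) → 𝒴) × D.Seed) :=
  ∑ ν ∈ Finset.Icc 1 A, (A : ENNReal)⁻¹ •
    (Measure.dirac ν).prod ((obsLaw P₀ P₁ n ν (A + n - 1)).prod D.seedLaw)

/-- The false-alarm probability `ℙ(τ < ν)`. -/
noncomputable def falseAlarm (P₀ P₁ : PMF 𝒴) (A n : ℕ) (D : Detector 𝒴 (A + n - 1)) : ℝ :=
  (jointLaw P₀ P₁ A n D).real {x | D.stopTime x.2.2 x.2.1 < x.1}

/-- The delay: the minimum `l ≥ 0` such that `ℙ(τ - ν ≤ l - 1) ≥ 1 - ε`. -/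
noncomputable def delay (P₀ P₁ : PMF 𝒴) (A n : ℕ) (D : Detector 𝒴 (A + n - 1)) (ε : ℝ) : ℕ :=
  sInf {l : ℕ | 1 - ε ≤
    (jointLaw P₀ P₁ A n D).real {x | (D.stopTime x.2.2 x.2.1 : ℤ) - (x.1 : ℤ) ≤ (l : ℤ) - 1}}

/-- The sampling rate: the minimum `r ≥ 0` such that `ℙ(|S^{≤ τ}| / τ ≤ r) ≥ 1 - ε`. -/
noncomputable def samplingRate (P₀ P₁ : PMF 𝒴) (A n : ℕ) (D : Detector 𝒴 (A + n - 1))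
    (ε : ℝ) : ℝ :=
  sInf {r : ℝ | 0 ≤ r ∧ 1 - ε ≤ (jointLaw P₀ P₁ A n D).real
    {x | (D.numSamples x.2.2 x.2.1 : ℝ) / (D.stopTime x.2.2 x.2.1 : ℝ) ≤ r}}

/-- The detectors `Dₙ`, with tolerances `εₙ`, achieve the sampling rates `ρₙ` at uncertainty
exponent `α`. -/
def Achieves (P₀ P₁ : PMF 𝒴) (α : ℝ) (ρ : ℕ → ℝ)
    (D : ∀ n : ℕ, Detector 𝒴 (level α n + n - 1)) (ε : ℕ → ℝ) : Prop :=
  (∀ n, 0 ≤ ε n) ∧ Tendsto ε atTop (𝓝 0) ∧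
    ∀ᶠ n : ℕ in atTop,
      falseAlarm P₀ P₁ (level α n) n (D n) ≤ ε n ∧
      samplingRate P₀ P₁ (level α n) n (D n) (ε n) ≤ ρ n ∧
      Real.logb 2 (delay P₀ P₁ (level α n) n (D n) (ε n)) / n ≤ ε n

/-- The sampling rates `ρₙ` are achievable at uncertainty exponent `α`. -/
def Achievable (P₀ P₁ : PMF 𝒴) (α : ℝ) (ρ : ℕ → ℝ) : Prop :=
  ∃ (D : ∀ n : ℕ, Detector 𝒴 (level α n + n - 1)) (ε : ℕ → ℝ), Achieves P₀ P₁ α ρ D ε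

end Model

/-- `n^*(α) = n α / D(P₁ ‖ P₀)`. -/
noncomputable def minDelay {𝒴 : Type*} [Fintype 𝒴] (P₀ P₁ : PMF 𝒴) (α : ℝ) (n : ℕ) : ℝ :=
  n * α / relEntropy P₁ P₀

section TypicalityTest

variable {𝒴 : Type*}

open Classical in
/-- The empirical distribution of the `k` observations at the times `t - k + 1, …, t`. -/
noncomputable def empirical {N : ℕ} (k t : ℕ) (y : Times N → 𝒴) (a : 𝒴) : ℝ :=
  ((Finset.univ.filter fun s : Times N => t < s + k ∧ (s : ℕ) ≤ t ∧ y s = a).card : ℝ) / k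

/-- The last `k` observations at time `t` exist and are typical with respect to `P`: their empirical
distribution is within `L¹`-distance `k^{-1/3}` of `P`. -/
def TypicalAt [Fintype 𝒴] (P : PMF 𝒴) {N : ℕ} (k t : ℕ) (y : Times N → 𝒴) : Prop :=
  k ≤ t ∧ ∑ a, |empirical k t y a - (P a).toReal| ≤ (k : ℝ) ^ (-(1 / 3) : ℝ)

theorem empirical_congr {N : ℕ} {k t : ℕ} {y y' : Times N → 𝒴}
    (h : ∀ s : Times N, (s : ℕ) ≤ t → y s = y' s) (a : 𝒴) :
    empirical k t y a = empirical k t y' a := by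
  classical
  unfold empirical
  congr 3
  ext s
  simp only [Finset.mem_filter, Finset.mem_univ, true_and]
  constructor
  · rintro ⟨h1, h2, h3⟩
    exact ⟨h1, h2, (h s h2) ▸ h3⟩
  · rintro ⟨h1, h2, h3⟩
    exact ⟨h1, h2, (h s h2).symm ▸ h3⟩

theorem typicalAt_congr [Fintype 𝒴] (P : PMF 𝒴) {N : ℕ} {k t : ℕ} {y y' : Times N → 𝒴}
    (h : ∀ s : Times N, (s : ℕ) ≤ t → y s = y' s) :
    TypicalAt P k t y ↔ TypicalAt P k t y' := by
  unfold TypicalAt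
  simp only [empirical_congr h]

/-- The first time in `{1, …, N}` at which the last `k` observations are typical with respect to `P`,
or `N` if there is no such time. -/
noncomputable def typicalityTime [Fintype 𝒴] (P : PMF 𝒴) (k N : ℕ) (y : Times N → 𝒴) : ℕ :=
  sInf {t : ℕ | (1 ≤ t ∧ t ≤ N ∧ TypicalAt P k t y) ∨ t = N}

theorem typicalityTime_mem [Fintype 𝒴] (P : PMF 𝒴) (k N : ℕ) (y : Times N → 𝒴) :
    (1 ≤ typicalityTime P k N y ∧ typicalityTime P k N y ≤ N ∧
      TypicalAt P k (typicalityTime P k N y) y) ∨ typicalityTime P k N y = N :=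
  Nat.sInf_mem (s := {t : ℕ | (1 ≤ t ∧ t ≤ N ∧ TypicalAt P k t y) ∨ t = N}) ⟨N, Or.inr rfl⟩

theorem typicalityTime_congr [Fintype 𝒴] (P : PMF 𝒴) (k N : ℕ) (y y' : Times N → 𝒴)
    (h : ∀ s : Times N, (s : ℕ) ≤ typicalityTime P k N y → y s = y' s) :
    typicalityTime P k N y' = typicalityTime P k N y := by
  have hle : typicalityTime P k N y' ≤ typicalityTime P k N y := by
    refine Nat.sInf_le ?_
    rcases typicalityTime_mem P k N y with ⟨h1, h2, h3⟩ | h1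
    · exact Or.inl ⟨h1, h2, (typicalAt_congr P h).1 h3⟩
    · exact Or.inr h1
  refine le_antisymm hle (Nat.sInf_le ?_)
  rcases typicalityTime_mem P k N y' with ⟨h1, h2, h3⟩ | h1
  · exact Or.inl ⟨h1, h2, (typicalAt_congr P fun s hs => h s (hs.trans hle)).2 h3⟩
  · exact Or.inr h1

/-- The sequential typicality test with window length `k`: a deterministic detector that samples at
every time and stops as soon as the last `k` observations are typical with respect to `P` (at the
end of the horizon if this never happens). -/
noncomputable def typicalityTest [Fintype 𝒴] (P : PMF 𝒴) (k N : ℕ) : Detector 𝒴 N where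
  Seed := Unit
  seedSpace := inferInstance
  seedLaw := Measure.dirac ()
  seedLaw_prob := inferInstance
  sample := fun _ _ => Finset.univ
  stopTime := fun _ y => typicalityTime P k N y
  measurable_sample := fun _ _ => .of_discrete
  measurable_stop := fun _ _ => .of_discrete
  adaptive := fun _ _ _ _ _ => by simp
  nonanticipating := fun _ y y' h =>
    typicalityTime_congr P k N y y' fun s hs => h s (Finset.mem_univ s) hs
  stop_pos := fun hN _ y => by
    rcases typicalityTime_mem P k N y with h | h
    · exact h.1
    · rw [h]; exact hN
  stop_le := fun _ y => Nat.sInf_le (Or.inr rfl)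

end TypicalityTest

end TransientChange

/-!
*Lower bound on the delay.* Let `d` be the delay of a detector. Up to `o(1)`, the event
`ν ≤ τ < ν + d` has probability one. Given `ν` and the seed, it is decided by the observations
before time `ν + d`, and only `m = min n d` of these have law `P₁`. By Chebyshev's inequality their
log-likelihood ratio is at most `m D(P₁ ‖ P₀) + o(n)` with high probability, so that replacing `P₁`
by `P₀` there lowers the probability of the event by a factor of at most `2^{m D + o(n)}`
(`obsLaw_detection_le`). When all observations have law `P₀`, their law no longer depends on `ν`,
and at most `d` of the events `ν ≤ τ < ν + d`, `1 ≤ ν ≤ A`, occur (`sum_real_detection_le`). Averaging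
over `ν` gives `1 - o(1) ≤ 2^{m D + o(n)} d / A` (`jointLaw_detection_le`). Since `A` is about
`2^{α n}` and `d` is subexponential, `α n ≤ min n d * D + o(n)` (`Achieves.eventually_le`). With
`min n d ≤ n` this bounds the achievable exponents by `D`, and with `min n d ≤ d` it
bounds the delay from below by `n α / D`, up to `o(n)`.

*Achievability.* A window of `k` observations of law `P₀` is typical for `P₁` with probability at
most `2^{-k D + O(k^{2/3} log k)}` (`obsLaw_typicalAt_le`). This is Chernoff's inequality for the
likelihood ratio, modified to `1 / k` outside the support of `P₁`, where its logarithm is not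
bounded. For `k = n α / D + n^{3/4}` the union bound over `2^{α n}` windows makes the
false-alarm probability vanish. Since `k ≤ n` for large `n`, a window of length `k` fits into the
changed segment, and by Chebyshev's inequality it is typical with high probability
(`obsLaw_not_typicalAt_le`); the delay is then at most `k`, which is asymptotic to `n α / D`.
-/

open MeasureTheory Filter Topology

namespace TransientChange

/-! ### Product laws on a finite alphabet -/

/-- If the log-likelihood ratio of the coordinates satisfying `C` is at most `c`, so is the one
of the two product laws. -/
theorem prod_ite_le_of_sum_logb_le {ι 𝒴 : Type*} [Fintype ι] (P₀ P₁ : PMF 𝒴)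
    (hfin : ∀ y, P₀ y = 0 → P₁ y = 0)
    (C : ι → Prop) [DecidablePred C] (y : ι → 𝒴) (c : ℝ)
    (h : ∑ i with C i, Real.logb 2 ((P₁ (y i)).toReal / (P₀ (y i)).toReal) ≤ c) :
    ∏ i, (if C i then P₁ else P₀) (y i) ≤ ENNReal.ofReal (2 ^ c) * ∏ i, P₀ (y i) := by
  rw [← Finset.prod_filter_mul_prod_filter_not Finset.univ C,
    ← Finset.prod_filter_mul_prod_filter_not Finset.univ C (fun i => P₀ (y i)), ← mul_assoc]
  refine mul_le_mul' ?_ (Finset.prod_le_prod' fun i hi => ?_)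
  swap
  · simp only [Finset.mem_filter] at hi; simp [hi.2]
  rw [Finset.prod_congr rfl (g := fun i => P₁ (y i)) fun i hi => by
    simp only [Finset.mem_filter] at hi; simp [hi.2]]
  by_cases h0 : ∃ i, C i ∧ P₁ (y i) = 0
  · obtain ⟨i, hi, h0⟩ := h0
    rw [Finset.prod_eq_zero (i := i) (by simp [hi]) h0]
    exact zero_le
  push Not at h0
  have hpos1 : ∀ i ∈ Finset.univ.filter C, 0 < (P₁ (y i)).toReal := fun i hi =>
    ENNReal.toReal_pos (h0 i (by simpa using hi)) (PMF.apply_ne_top _ _)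
  have hpos0 : ∀ i ∈ Finset.univ.filter C, 0 < (P₀ (y i)).toReal := fun i hi =>
    ENNReal.toReal_pos (fun h => h0 i (by simpa using hi) (hfin _ h)) (PMF.apply_ne_top _ _)
  rw [← Real.logb_prod _ _ fun i hi => (div_pos (hpos1 i hi) (hpos0 i hi)).ne',
    Real.logb_le_iff_le_rpow (by norm_num)
      (Finset.prod_pos fun i hi => div_pos (hpos1 i hi) (hpos0 i hi)),
    Finset.prod_div_distrib, div_le_iff₀ (Finset.prod_pos hpos0)] at h
  have e : ∀ P : PMF 𝒴, ∏ i with C i, P (y i) =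
      ENNReal.ofReal (∏ i with C i, (P (y i)).toReal) := by
    intro P
    rw [ENNReal.ofReal_prod_of_nonneg fun i _ => ENNReal.toReal_nonneg]
    exact Finset.prod_congr rfl fun i _ => (ENNReal.ofReal_toReal (PMF.apply_ne_top _ _)).symm
  rw [e, e, ← ENNReal.ofReal_mul (by positivity)]
  exact ENNReal.ofReal_le_ofReal h

theorem pi_toMeasure_singleton {ι 𝒴 : Type*} [Fintype ι] [MeasurableSpace 𝒴]
    [MeasurableSingletonClass 𝒴] (p : ι → PMF 𝒴) (y : ι → 𝒴) :
    Measure.pi (fun i => (p i).toMeasure) {y} = ∏ i, p i (y i) := by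
  rw [Measure.pi_singleton]
  exact Finset.prod_congr rfl fun i _ => PMF.toMeasure_apply_singleton _ _ (.singleton _)

section FiniteProduct

variable {ι 𝒴 : Type*} [Fintype ι] [Fintype 𝒴] [MeasurableSpace 𝒴] [MeasurableSingletonClass 𝒴]

/-- Change of measure between two product laws on a set `G` where the density is at most `c`. -/
theorem pi_toMeasure_inter_le (p q : ι → PMF 𝒴) (c : ENNReal) (E G : Set (ι → 𝒴))
    (h : ∀ y ∈ G, ∏ i, p i (y i) ≤ c * ∏ i, q i (y i)) :
    Measure.pi (fun i => (p i).toMeasure) (E ∩ G) ≤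
      c * Measure.pi (fun i => (q i).toMeasure) E := by
  classical
  have hs : ∀ F : Set (ι → 𝒴), F = ((Set.toFinite F).toFinset : Set (ι → 𝒴)) := by simp
  calc Measure.pi (fun i => (p i).toMeasure) (E ∩ G)
      = ∑ y ∈ (Set.toFinite (E ∩ G)).toFinset, ∏ i, p i (y i) := by
        conv_lhs => rw [hs (E ∩ G), ← sum_measure_singleton]
        simp_rw [pi_toMeasure_singleton]
    _ ≤ ∑ y ∈ (Set.toFinite (E ∩ G)).toFinset, c * ∏ i, q i (y i) :=
        Finset.sum_le_sum fun y hy => h y (by simpa using ((Set.Finite.mem_toFinset _).1 hy).2)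
    _ = c * Measure.pi (fun i => (q i).toMeasure) (E ∩ G) := by
        conv_rhs => rw [hs (E ∩ G), ← sum_measure_singleton]
        simp_rw [pi_toMeasure_singleton, Finset.mul_sum]
    _ ≤ _ := by gcongr; exact Set.inter_subset_left

/-- A product law gives to an event that depends only on the coordinates in `S` a probability that
depends only on the marginals in `S`. -/
theorem pi_toMeasure_congr (p q : ι → PMF 𝒴) (S : Finset ι) (h : ∀ i ∈ S, p i = q i)
    (E : Set (ι → 𝒴)) (hE : ∀ y y', (∀ i ∈ S, y i = y' i) → y ∈ E → y' ∈ E) :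
    Measure.pi (fun i => (p i).toMeasure) E = Measure.pi (fun i => (q i).toMeasure) E := by
  have key : ∀ p : ι → PMF 𝒴, Measure.pi (fun i => (p i).toMeasure) E =
      Measure.pi (fun i : S => (p i).toMeasure) (S.restrict '' E) := by
    intro p
    rw [← Measure.infinitePi_map_restrict (μ := fun i => (p i).toMeasure),
      Measure.map_apply (by fun_prop) (Set.toFinite _).measurableSet, Measure.infinitePi_eq_pi]
    congr 1
    refine Set.Subset.antisymm (Set.subset_preimage_image _ _) ?_
    rintro y' ⟨y, hy, hyy⟩
    exact hE y y' (fun i hi => congrFun hyy ⟨i, hi⟩) hy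
  rw [key p, key q]
  congr 2
  funext i
  rw [h i i.2]

/-- Chebyshev's inequality for the sum of a function of the coordinates in `I`, which are
identically distributed. -/
theorem pi_toMeasure_chebyshev (p : ι → PMF 𝒴) (I : Finset ι) (P : PMF 𝒴)
    (hI : ∀ i ∈ I, p i = P) (f : 𝒴 → ℝ) {c : ℝ} (hc : 0 < c) :
    (Measure.pi fun i => (p i).toMeasure).real
      {y | c ≤ |∑ i ∈ I, f (y i) - I.card * ∑ a, (P a).toReal * f a|} ≤
      I.card * (∑ a, (P a).toReal * f a ^ 2) / c ^ 2 := by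
  set μ := Measure.pi fun i => (p i).toMeasure with hμ
  have hf : Measurable f := measurable_of_finite f
  have hmem : ∀ (Q : PMF 𝒴) (g : 𝒴 → ℝ), MemLp g 2 Q.toMeasure := fun Q g => .of_discrete
  have hmp : ∀ i, MeasurePreserving (Function.eval i) μ (p i).toMeasure :=
    fun i => measurePreserving_eval _ i
  have hL : ∀ i, MemLp (fun y : ι → 𝒴 => f (y i)) 2 μ := fun i =>
    (hmem (p i) f).comp_measurePreserving (hmp i)
  have hint : ∀ i ∈ I, ∀ g : 𝒴 → ℝ, ∫ y, g (y i) ∂μ = ∑ a, (P a).toReal * g a := by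
    intro i hi g
    rw [← hI i hi, ← integral_map (φ := fun y : ι → 𝒴 => y i) (f := g)
      (hmp i).measurable.aemeasurable (measurable_of_finite g).aestronglyMeasurable]
    rw [show Measure.map (fun y : ι → 𝒴 => y i) μ = (p i).toMeasure from (hmp i).map_eq,
      PMF.integral_eq_sum]
    simp
  have hE : ∫ y, (∑ i ∈ I, fun y : ι → 𝒴 => f (y i)) y ∂μ = I.card * ∑ a, (P a).toReal * f a := by
    simp only [Finset.sum_apply]
    rw [integral_finsetSum _ fun i _ => (hL i).integrable (by norm_num),
      Finset.sum_congr rfl fun i hi => hint i hi f]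
    simp
  have hV : ProbabilityTheory.variance (∑ i ∈ I, fun y : ι → 𝒴 => f (y i)) μ ≤
      I.card * ∑ a, (P a).toReal * f a ^ 2 := by
    have hind := ProbabilityTheory.iIndepFun_pi (μ := fun i => (p i).toMeasure)
      (X := fun _ => f) fun i => hf.aemeasurable
    rw [ProbabilityTheory.IndepFun.variance_sum (fun i _ => hL i)
      (fun i _ j _ hij => hind.indepFun hij)]
    calc _ ≤ ∑ i ∈ I, ∑ a, (P a).toReal * f a ^ 2 := by
          refine Finset.sum_le_sum fun i hi => ?_
          rw [← hint i hi fun a => f a ^ 2]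
          exact ProbabilityTheory.variance_le_expectation_sq (hL i).aestronglyMeasurable
      _ = _ := by simp
  have := ProbabilityTheory.meas_ge_le_variance_div_sq (memLp_finsetSum' I fun i _ => hL i) hc
  rw [hE] at this
  simp only [Finset.sum_apply] at this
  refine ENNReal.toReal_le_of_le_ofReal (by positivity) (this.trans ?_)
  gcongr

/-- Chernoff's inequality for the coordinates in `I`, which are identically distributed. -/
theorem pi_toMeasure_chernoff (p : ι → PMF 𝒴) (I : Finset ι) (P : PMF 𝒴)
    (hI : ∀ i ∈ I, p i = P) (g : 𝒴 → ℝ) (hg : ∀ a, 0 < g a) (b : ℝ) :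
    (Measure.pi fun i => (p i).toMeasure).real {y | b ≤ ∑ i ∈ I, Real.logb 2 (g (y i))} ≤
      (∑ a, (P a).toReal * g a) ^ I.card / 2 ^ b := by
  classical
  set μ := Measure.pi fun i => (p i).toMeasure with hμ
  have hint : ∫ y, ∏ i ∈ I, g (y i) ∂μ = (∑ a, (P a).toReal * g a) ^ I.card := by
    have h1 : ∀ y : ι → 𝒴, ∏ i ∈ I, g (y i) = ∏ i, if i ∈ I then g (y i) else 1 := by
      simp
    have h2 : ∀ i, ∫ a, (if i ∈ I then g a else 1) ∂(p i).toMeasure =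
        if i ∈ I then ∑ a, (P a).toReal * g a else 1 := by
      intro i
      split_ifs with hi
      · simp [PMF.integral_eq_sum, hI i hi]
      · simp
    simp_rw [h1]
    rw [integral_fintype_prod_eq_prod (μ := fun i => (p i).toMeasure)
      (f := fun i a => if i ∈ I then g a else 1), Finset.prod_congr rfl fun i _ => h2 i]
    simp
  have hmk := mul_meas_ge_le_integral_of_nonneg (μ := μ) (f := fun y => ∏ i ∈ I, g (y i))
    (.of_forall fun y => Finset.prod_nonneg fun i _ => (hg _).le) .of_finite ((2 : ℝ) ^ b)
  rw [hint] at hmk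
  rw [le_div_iff₀' (by positivity)]
  refine le_trans (mul_le_mul_of_nonneg_left ?_ (by positivity)) hmk
  refine measureReal_mono fun y hy => ?_
  simp only [Set.mem_ofPred_eq] at hy ⊢
  rw [← Real.logb_prod _ _ fun i _ => (hg _).ne'] at hy
  exact (Real.le_logb_iff_rpow_le (by norm_num)
    (Finset.prod_pos fun i _ => hg _)).1 hy

end FiniteProduct

/-! ### The joint law of the change point, the observations and the seed -/

section Window

theorem card_window {N a m : ℕ} (ha : 1 ≤ a) (h : a + m ≤ N + 1) :
    (Finset.univ.filter fun s : Times N => a ≤ (s : ℕ) ∧ (s : ℕ) < a + m).card = m := by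
  have : (Finset.univ.filter fun s : Times N => a ≤ (s : ℕ) ∧ (s : ℕ) < a + m).card =
      (Finset.Ico a (a + m)).card := by
    refine Finset.card_nbij (fun s => (s : ℕ)) ?_ (fun _ _ _ _ h => Subtype.ext h) ?_
    · intro s hs
      simpa using hs
    · intro s hs
      simp only [Finset.coe_Ico, Set.mem_Ico] at hs
      exact ⟨⟨s, Finset.mem_Icc.2 ⟨by omega, by omega⟩⟩, by simpa using hs, rfl⟩
  simpa using this

end Window

section JointLaw

variable {𝒴 : Type*} [MeasurableSpace 𝒴]

instance (P₀ P₁ : PMF 𝒴) (n ν N : ℕ) : IsProbabilityMeasure (obsLaw P₀ P₁ n ν N) := by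
  unfold obsLaw; infer_instance

theorem jointLaw_isProbabilityMeasure (P₀ P₁ : PMF 𝒴) {A : ℕ} (hA : 0 < A) (n : ℕ)
    (D : Detector 𝒴 (A + n - 1)) : IsProbabilityMeasure (jointLaw P₀ P₁ A n D) := by
  constructor
  simp only [jointLaw, Measure.finsetSum_apply, Measure.smul_apply, measure_univ, smul_eq_mul,
    mul_one, Finset.sum_const, Nat.card_Icc, add_tsub_cancel_right, nsmul_eq_mul]
  exact ENNReal.mul_inv_cancel (by simp [hA.ne']) (by simp)

variable [Fintype 𝒴] [MeasurableSingletonClass 𝒴]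

theorem Detector.measurable_stopTime {N : ℕ} (D : Detector 𝒴 N) :
    Measurable fun z : (Times N → 𝒴) × D.Seed => D.stopTime z.2 z.1 :=
  measurable_from_prod_countable_right fun y => measurable_to_countable' fun t =>
    Detector.measurable_stop D y t

theorem Detector.measurable_change_stopTime {N : ℕ} (D : Detector 𝒴 N) :
    Measurable fun x : ℕ × (Times N → 𝒴) × D.Seed => (x.1, D.stopTime x.2.2 x.2.1) :=
  measurable_fst.prodMk (D.measurable_stopTime.comp measurable_snd)

/-- The joint law is the average over the change point of the conditional laws. -/
theorem jointLaw_real_eq (P₀ P₁ : PMF 𝒴) (A n : ℕ) (D : Detector 𝒴 (A + n - 1))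
    (p : ℕ → ℕ → Prop) :
    (jointLaw P₀ P₁ A n D).real {x | p x.1 (D.stopTime x.2.2 x.2.1)} =
      (A : ℝ)⁻¹ * ∑ ν ∈ Finset.Icc 1 A, ((obsLaw P₀ P₁ n ν (A + n - 1)).prod D.seedLaw).real
        {z | p ν (D.stopTime z.2 z.1)} := by
  have hS : MeasurableSet {x : ℕ × (Times (A + n - 1) → 𝒴) × D.Seed |
      p x.1 (D.stopTime x.2.2 x.2.1)} :=
    D.measurable_change_stopTime (Set.to_countable {q : ℕ × ℕ | p q.1 q.2}).measurableSet
  simp only [Measure.real, jointLaw, Measure.finsetSum_apply, Measure.smul_apply, smul_eq_mul]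
  rw [← Finset.mul_sum, ENNReal.toReal_mul, ENNReal.toReal_sum (by finiteness)]
  congr 1
  · simp
  · refine Finset.sum_congr rfl fun ν _ => ?_
    rw [Measure.dirac_prod, Measure.map_apply measurable_prodMk_left hS]
    rfl

end JointLaw

/-! ### Change of measure for a detection event -/

section Converse

variable {𝒴 : Type*} [Fintype 𝒴] [MeasurableSpace 𝒴] [MeasurableSingletonClass 𝒴]

/-- The second moment of the log-likelihood ratio under `P`. -/
noncomputable def llrSecondMoment (P Q : PMF 𝒴) : ℝ :=
  ∑ y, (P y).toReal * Real.logb 2 ((P y).toReal / (Q y).toReal) ^ 2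

omit [MeasurableSpace 𝒴] [MeasurableSingletonClass 𝒴] in
theorem llrSecondMoment_nonneg (P Q : PMF 𝒴) : 0 ≤ llrSecondMoment P Q :=
  Finset.sum_nonneg fun _ _ => by positivity

/-- The log-likelihood ratio of `m` observations after the change is at most `m D(P₁ ‖ P₀) + s`,
up to an event of probability `O(m / s²)`. -/
theorem obsLaw_llr_tail (P₀ P₁ : PMF 𝒴) {m ν N : ℕ} (hν : 1 ≤ ν) (hN : ν + m ≤ N + 1)
    {s : ℝ} (hs : 0 < s) :
    (obsLaw P₀ P₁ m ν N).real {y | ¬ ∑ t ∈ Finset.univ.filter fun t : Times N =>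
        ν ≤ (t : ℕ) ∧ (t : ℕ) < ν + m,
        Real.logb 2 ((P₁ (y t)).toReal / (P₀ (y t)).toReal) ≤ m * relEntropy P₁ P₀ + s} ≤
      m * llrSecondMoment P₁ P₀ / s ^ 2 := by
  have h := pi_toMeasure_chebyshev
    (fun t : Times N => if ν ≤ (t : ℕ) ∧ (t : ℕ) < ν + m then P₁ else P₀)
    (Finset.univ.filter fun t : Times N => ν ≤ (t : ℕ) ∧ (t : ℕ) < ν + m) P₁
    (fun i hi => if_pos (by simpa using hi))
    (fun a => Real.logb 2 ((P₁ a).toReal / (P₀ a).toReal)) hs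
  rw [card_window hν hN] at h
  refine le_trans (measureReal_mono fun y hy => ?_) h
  simp only [Set.mem_ofPred_eq, not_le] at hy ⊢
  refine le_trans ?_ (le_abs_self _)
  unfold relEntropy at hy
  linarith

/-- Change of measure for the event that a change at `ν` is detected with delay at most `d`. This
event is decided by the observations before time `ν + d`, of which at most `min n d` have
law `P₁`. -/
theorem obsLaw_detection_le (P₀ P₁ : PMF 𝒴) (hfin : ∀ y, P₀ y = 0 → P₁ y = 0) {n ν d N : ℕ}
    (hν : 1 ≤ ν) (hN : ν + n ≤ N + 1) (D : Detector 𝒴 N) (ω : D.Seed) {s : ℝ} (hs : 0 < s) :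
    obsLaw P₀ P₁ n ν N {y | ν ≤ D.stopTime ω y ∧ D.stopTime ω y < ν + d} ≤
      ENNReal.ofReal (2 ^ ((min n d : ℕ) * relEntropy P₁ P₀ + s)) *
        obsLaw P₀ P₁ 0 0 N {y | ν ≤ D.stopTime ω y ∧ D.stopTime ω y < ν + d} +
      ENNReal.ofReal ((min n d : ℕ) * llrSecondMoment P₁ P₀ / s ^ 2) := by
  set m := min n d with hm
  set E : Set (Times N → 𝒴) := {y | ν ≤ D.stopTime ω y ∧ D.stopTime ω y < ν + d} with hE
  set G : Set (Times N → 𝒴) := {y | ∑ t ∈ Finset.univ.filter fun t : Times N =>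
      ν ≤ (t : ℕ) ∧ (t : ℕ) < ν + m,
    Real.logb 2 ((P₁ (y t)).toReal / (P₀ (y t)).toReal) ≤ m * relEntropy P₁ P₀ + s} with hG
  -- The event `E` does not see the observations from time `ν + d` on, so that these may be given
  -- the law `P₀`.
  have h1 : obsLaw P₀ P₁ n ν N E = obsLaw P₀ P₁ m ν N E := by
    refine pi_toMeasure_congr _ _ (Finset.univ.filter fun t : Times N => (t : ℕ) < ν + d) ?_ E ?_
    · intro t ht
      simp only [Finset.mem_filter, Finset.mem_univ, true_and] at ht
      have : (ν ≤ (t : ℕ) ∧ (t : ℕ) < ν + n) ↔ (ν ≤ (t : ℕ) ∧ (t : ℕ) < ν + m) := by omega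
      simp only [this]
    · intro y y' hyy hy
      have : D.stopTime ω y' = D.stopTime ω y := D.nonanticipating ω y y' fun t _ ht =>
        hyy t (by simpa using ht.trans_lt hy.2)
      simpa only [hE, Set.mem_ofPred_eq, this] using hy
  rw [h1]
  have h2 : obsLaw P₀ P₁ m ν N (E ∩ G) ≤
      ENNReal.ofReal (2 ^ (m * relEntropy P₁ P₀ + s)) * obsLaw P₀ P₁ 0 0 N E := by
    refine pi_toMeasure_inter_le _ _ _ E G fun y hy => ?_
    refine (prod_ite_le_of_sum_logb_le P₀ P₁ hfin _ y _ hy).trans_eq ?_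
    simp
  have h3 : obsLaw P₀ P₁ m ν N Gᶜ ≤ ENNReal.ofReal (m * llrSecondMoment P₁ P₀ / s ^ 2) := by
    rw [ENNReal.le_ofReal_iff_toReal_le (by finiteness)
      (by have := llrSecondMoment_nonneg P₁ P₀; positivity)]
    exact obsLaw_llr_tail P₀ P₁ hν (by omega) hs
  calc obsLaw P₀ P₁ m ν N E ≤ obsLaw P₀ P₁ m ν N (E ∩ G ∪ Gᶜ) :=
        measure_mono fun y hy => by by_cases h : y ∈ G <;> simp [h, hy]
    _ ≤ _ := (measure_union_le _ _).trans (add_le_add h2 h3)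

/-- Under any law of the observations, at most `d` of the events `ν ≤ τ < ν + d` occur. -/
theorem sum_real_detection_le {N : ℕ} (D : Detector 𝒴 N) (μ : Measure ((Times N → 𝒴) × D.Seed))
    [IsProbabilityMeasure μ] (A d : ℕ) :
    ∑ ν ∈ Finset.Icc 1 A, μ.real {z | ν ≤ D.stopTime z.2 z.1 ∧ D.stopTime z.2 z.1 < ν + d} ≤ d := by
  have hmeas : ∀ ν, MeasurableSet {z : (Times N → 𝒴) × D.Seed |
      ν ≤ D.stopTime z.2 z.1 ∧ D.stopTime z.2 z.1 < ν + d} := fun ν =>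
    D.measurable_stopTime (Set.to_countable {t : ℕ | ν ≤ t ∧ t < ν + d}).measurableSet
  have hint : ∀ ν, Integrable (Set.indicator {z : (Times N → 𝒴) × D.Seed |
      ν ≤ D.stopTime z.2 z.1 ∧ D.stopTime z.2 z.1 < ν + d} (1 : (Times N → 𝒴) × D.Seed → ℝ)) μ :=
    fun ν => (integrable_const (1 : ℝ)).indicator (hmeas ν)
  simp_rw [← fun ν => integral_indicator_one (μ := μ) (hmeas ν)]
  rw [← integral_finsetSum _ fun ν _ => hint ν]
  refine (integral_mono (g := fun _ => (d : ℝ)) (integrable_finsetSum _ fun ν _ => hint ν)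
    (integrable_const _) fun z => ?_).trans (by simp)
  classical
  simp only [Set.indicator_apply, Set.mem_ofPred_eq, Pi.one_apply, Finset.sum_boole]
  norm_cast
  refine (Finset.card_le_card (t := Finset.Ico (D.stopTime z.2 z.1 + 1 - d)
    (D.stopTime z.2 z.1 + 1)) fun ν hν => ?_).trans (by rw [Nat.card_Ico]; omega)
  simp only [Finset.mem_filter, Finset.mem_Icc, Finset.mem_Ico] at hν ⊢
  omega

/-- The probability that the change is detected with delay at most `d`, by any detector: the change
of measure for each change point, averaged over the change points, with the counting bound
`sum_real_detection_le` for observations of law `P₀` only. -/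
theorem jointLaw_detection_le (P₀ P₁ : PMF 𝒴) (hfin : ∀ y, P₀ y = 0 → P₁ y = 0) {A : ℕ}
    (hA : 0 < A) (n d : ℕ) (D : Detector 𝒴 (A + n - 1)) {s : ℝ} (hs : 0 < s) :
    (jointLaw P₀ P₁ A n D).real
        {x | x.1 ≤ D.stopTime x.2.2 x.2.1 ∧ D.stopTime x.2.2 x.2.1 < x.1 + d} ≤
      2 ^ ((min n d : ℕ) * relEntropy P₁ P₀ + s) * d / A +
        (min n d : ℕ) * llrSecondMoment P₁ P₀ / s ^ 2 := by
  set c : ℝ := 2 ^ ((min n d : ℕ) * relEntropy P₁ P₀ + s) with hc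
  set δ : ℝ := (min n d : ℕ) * llrSecondMoment P₁ P₀ / s ^ 2 with hδ
  have hδ0 : 0 ≤ δ := by have := llrSecondMoment_nonneg P₁ P₀; positivity
  have hc0 : 0 ≤ c := by positivity
  have hmeas : ∀ ν, MeasurableSet {z : (Times (A + n - 1) → 𝒴) × D.Seed |
      ν ≤ D.stopTime z.2 z.1 ∧ D.stopTime z.2 z.1 < ν + d} := fun ν =>
    D.measurable_stopTime (Set.to_countable {t : ℕ | ν ≤ t ∧ t < ν + d}).measurableSet
  have key : ∀ ν ∈ Finset.Icc 1 A, ((obsLaw P₀ P₁ n ν (A + n - 1)).prod D.seedLaw).real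
      {z | ν ≤ D.stopTime z.2 z.1 ∧ D.stopTime z.2 z.1 < ν + d} ≤
      c * ((obsLaw P₀ P₁ 0 0 (A + n - 1)).prod D.seedLaw).real
        {z | ν ≤ D.stopTime z.2 z.1 ∧ D.stopTime z.2 z.1 < ν + d} + δ := by
    intro ν hν
    rw [Finset.mem_Icc] at hν
    have h : (obsLaw P₀ P₁ n ν (A + n - 1)).prod D.seedLaw
        {z | ν ≤ D.stopTime z.2 z.1 ∧ D.stopTime z.2 z.1 < ν + d} ≤
        ENNReal.ofReal c * (obsLaw P₀ P₁ 0 0 (A + n - 1)).prod D.seedLaw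
          {z | ν ≤ D.stopTime z.2 z.1 ∧ D.stopTime z.2 z.1 < ν + d} + ENNReal.ofReal δ := by
      rw [Measure.prod_apply_symm (hmeas ν), Measure.prod_apply_symm (hmeas ν),
        ← lintegral_const_mul _ (measurable_measure_prodMk_right (hmeas ν))]
      calc _ ≤ ∫⁻ ω, (ENNReal.ofReal c * obsLaw P₀ P₁ 0 0 (A + n - 1) ((fun y => (y, ω)) ⁻¹'
              {z | ν ≤ D.stopTime z.2 z.1 ∧ D.stopTime z.2 z.1 < ν + d}) +
              ENNReal.ofReal δ) ∂D.seedLaw :=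
            lintegral_mono fun ω => obsLaw_detection_le P₀ P₁ hfin hν.1 (by omega) D ω hs
        _ = _ := by rw [lintegral_add_right _ measurable_const]; simp
    have h' := ENNReal.toReal_mono (by finiteness) h
    rwa [ENNReal.toReal_add (by finiteness) (by finiteness), ENNReal.toReal_mul,
      ENNReal.toReal_ofReal hc0, ENNReal.toReal_ofReal hδ0] at h'
  rw [jointLaw_real_eq P₀ P₁ A n D fun ν t => ν ≤ t ∧ t < ν + d]
  have hA' : (0 : ℝ) < A := by exact_mod_cast hA
  calc _ ≤ (A : ℝ)⁻¹ * (c * d + A * δ) := by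
        gcongr
        refine (Finset.sum_le_sum key).trans ?_
        rw [Finset.sum_add_distrib, ← Finset.mul_sum]
        refine add_le_add ?_ (by simp)
        gcongr
        exact sum_real_detection_le D _ A d
    _ = _ := by field_simp

end Converse

/-! ### Lower bounds for the delay -/

section ConverseAsymptotics

variable {𝒴 : Type*} [Fintype 𝒴] [MeasurableSpace 𝒴] [MeasurableSingletonClass 𝒴]

omit [MeasurableSpace 𝒴] [MeasurableSingletonClass 𝒴] in
theorem sum_toReal_pmf (P : PMF 𝒴) : ∑ a, (P a).toReal = 1 := by
  rw [← ENNReal.toReal_sum fun a _ => P.apply_ne_top a, ← tsum_fintype (L := .unconditional 𝒴),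
    P.tsum_coe, ENNReal.toReal_one]

omit [MeasurableSpace 𝒴] [MeasurableSingletonClass 𝒴] in
/-- Gibbs' inequality. -/
theorem relEntropy_nonneg (P₀ P₁ : PMF 𝒴) (hfin : ∀ y, P₀ y = 0 → P₁ y = 0) :
    0 ≤ relEntropy P₁ P₀ := by
  have hterm : ∀ a, ((P₁ a).toReal - (P₀ a).toReal) / Real.log 2 ≤
      (P₁ a).toReal * Real.logb 2 ((P₁ a).toReal / (P₀ a).toReal) := by
    intro a
    rw [Real.logb, ← mul_div_assoc]
    refine div_le_div_of_nonneg_right ?_ (Real.log_nonneg (by norm_num))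
    rcases eq_or_ne (P₁ a) 0 with h | h
    · simp [h]
    have h1 : 0 < (P₁ a).toReal := ENNReal.toReal_pos h (P₁.apply_ne_top a)
    have h0 : 0 < (P₀ a).toReal :=
      ENNReal.toReal_pos (fun h0 => h (hfin a h0)) (P₀.apply_ne_top a)
    have := Real.one_sub_inv_le_log_of_pos (div_pos h1 h0)
    calc (P₁ a).toReal - (P₀ a).toReal
        = (P₁ a).toReal * (1 - ((P₁ a).toReal / (P₀ a).toReal)⁻¹) := by field_simp
      _ ≤ _ := by gcongr
  calc (0 : ℝ) = ∑ a, ((P₁ a).toReal - (P₀ a).toReal) / Real.log 2 := by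
        rw [← Finset.sum_div, Finset.sum_sub_distrib, sum_toReal_pmf, sum_toReal_pmf]; simp
    _ ≤ _ := Finset.sum_le_sum fun a _ => hterm a

theorem level_pos {α : ℝ} (hα : 0 ≤ α) (n : ℕ) : 0 < level α n :=
  Nat.floor_pos.2 (Real.one_le_rpow (by norm_num) (by positivity))

theorem rpow_le_two_mul_level {α : ℝ} (hα : 0 ≤ α) (n : ℕ) :
    (2 : ℝ) ^ (α * n) ≤ 2 * level α n := by
  have h1 : (1 : ℝ) ≤ level α n := by exact_mod_cast level_pos hα n
  have h2 := Nat.lt_floor_add_one ((2 : ℝ) ^ (α * n))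
  unfold level at *
  linarith

omit [Fintype 𝒴] [MeasurableSingletonClass 𝒴] in
/-- The minimum in the definition of the delay is attained. -/
theorem one_sub_le_of_delay (P₀ P₁ : PMF 𝒴) {A : ℕ} (hA : 0 < A) (n : ℕ)
    (D : Detector 𝒴 (A + n - 1)) {ε : ℝ} (hε : 0 ≤ ε) :
    1 - ε ≤ (jointLaw P₀ P₁ A n D).real {x | (D.stopTime x.2.2 x.2.1 : ℤ) - (x.1 : ℤ) ≤
      (delay P₀ P₁ A n D ε : ℤ) - 1} := by
  have := jointLaw_isProbabilityMeasure P₀ P₁ hA n D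
  refine Nat.sInf_mem (s := {l : ℕ | 1 - ε ≤ (jointLaw P₀ P₁ A n D).real
    {x | (D.stopTime x.2.2 x.2.1 : ℤ) - (x.1 : ℤ) ≤ (l : ℤ) - 1}}) ⟨A + n - 1 + 1, ?_⟩
  rw [Set.mem_ofPred_eq, show {x : ℕ × (Times (A + n - 1) → 𝒴) × D.Seed |
    (D.stopTime x.2.2 x.2.1 : ℤ) - (x.1 : ℤ) ≤ ((A + n - 1 + 1 : ℕ) : ℤ) - 1} = Set.univ from
      Set.eq_univ_of_forall fun x => by
        have := D.stop_le x.2.2 x.2.1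
        simp only [Set.mem_ofPred_eq]
        omega]
  simp [hε]

/-- The number `min n d` of observations with law `P₁` that are available within the delay carries
an information of at least `α n` bits, up to `o(n)`. -/
theorem Achieves.eventually_le {P₀ P₁ : PMF 𝒴} (hfin : ∀ y, P₀ y = 0 → P₁ y = 0) {α : ℝ}
    (hα : 0 ≤ α) {ρ : ℕ → ℝ} {D : ∀ n : ℕ, Detector 𝒴 (level α n + n - 1)} {ε : ℕ → ℝ}
    (h : Achieves P₀ P₁ α ρ D ε) {η : ℝ} (hη : 0 < η) :
    ∀ᶠ n : ℕ in atTop, α * n ≤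
      (min n (delay P₀ P₁ (level α n) n (D n) (ε n)) : ℕ) * relEntropy P₁ P₀ + η * n := by
  obtain ⟨hε0, hε, hev⟩ := h
  -- Three error terms of size `η n / 4` arise: the deviation of the log-likelihood ratio, the
  -- logarithm of the delay, and the logarithm of the constant factors.
  have hV := llrSecondMoment_nonneg P₁ P₀
  have hlim : Tendsto (fun n : ℕ => llrSecondMoment P₁ P₀ / (η / 4) ^ 2 / n) atTop (𝓝 0) :=
    tendsto_const_div_atTop_nhds_zero_nat _
  have hlin : Tendsto (fun n : ℕ => (η / 4) * (n : ℝ)) atTop atTop :=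
    tendsto_natCast_atTop_atTop.const_mul_atTop (by positivity)
  filter_upwards [hev, eventually_ge_atTop 1, hε.eventually_le_const (u := 1 / 8) (by norm_num),
    hε.eventually_le_const (u := η / 4) (by positivity),
    hlim.eventually_le_const (u := 1 / 4) (by norm_num), hlin.eventually_ge_atTop 2]
    with n hall hn hε1 hε2 hV4 hn2
  obtain ⟨hfa, -, hlog⟩ := hall
  set d := delay P₀ P₁ (level α n) n (D n) (ε n) with hd
  set A := level α n with hA
  have hApos : 0 < A := level_pos hα n
  have hnpos : (0 : ℝ) < n := by exact_mod_cast hn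
  have hprob := jointLaw_isProbabilityMeasure P₀ P₁ hApos n (D n)
  have hs : 0 < (η / 4) * (n : ℝ) := by positivity
  have h1 := one_sub_le_of_delay P₀ P₁ hApos n (D n) (hε0 n)
  have h2 := jointLaw_detection_le P₀ P₁ hfin hApos n d (D n) hs
  have h3 : (jointLaw P₀ P₁ A n (D n)).real
      {x | ((D n).stopTime x.2.2 x.2.1 : ℤ) - (x.1 : ℤ) ≤ (d : ℤ) - 1} ≤
      falseAlarm P₀ P₁ A n (D n) + (jointLaw P₀ P₁ A n (D n)).real
        {x | x.1 ≤ (D n).stopTime x.2.2 x.2.1 ∧ (D n).stopTime x.2.2 x.2.1 < x.1 + d} := by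
    refine (measureReal_mono fun x hx => ?_).trans (measureReal_union_le _ _)
    simp only [Set.mem_ofPred_eq, Set.mem_union] at hx ⊢
    omega
  have h4 : (min n d : ℕ) * llrSecondMoment P₁ P₀ / ((η / 4) * (n : ℝ)) ^ 2 ≤ 1 / 4 := by
    refine le_trans ?_ hV4
    calc _ ≤ (n : ℝ) * llrSecondMoment P₁ P₀ / ((η / 4) * (n : ℝ)) ^ 2 := by
          gcongr; exact min_le_left _ _
      _ = _ := by field_simp
  set c : ℝ := (min n d : ℕ) * relEntropy P₁ P₀ with hc
  have hAr : (0 : ℝ) < A := by exact_mod_cast hApos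
  have h5 : 1 / 2 ≤ 2 ^ (c + (η / 4) * n) * (d : ℝ) / A := by linarith
  rw [le_div_iff₀ hAr] at h5
  have h6 : (2 : ℝ) ^ (α * n) ≤ 4 * (2 ^ (c + (η / 4) * n) * (d : ℝ)) := by
    have := rpow_le_two_mul_level hα n
    rw [← hA] at this
    linarith
  have hdpos : (0 : ℝ) < d := by
    rcases Nat.eq_zero_or_pos d with h0 | h0
    · rw [h0] at h5; simp only [Nat.cast_zero, mul_zero] at h5; linarith
    · exact_mod_cast h0
  have hlog4 : Real.logb 2 4 = 2 := by
    rw [show (4 : ℝ) = 2 ^ (2 : ℝ) by norm_num, Real.logb_rpow (by norm_num) (by norm_num)]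
  have h7 : α * n ≤ 2 + (c + (η / 4) * n + Real.logb 2 d) := by
    have h8 := Real.logb_le_logb_of_le (b := 2) (by norm_num) (by positivity) h6
    rw [Real.logb_mul (by norm_num) (by positivity), Real.logb_mul (by positivity) hdpos.ne',
      Real.logb_rpow (by norm_num) (by norm_num), Real.logb_rpow (by norm_num) (by norm_num),
      hlog4] at h8
    exact h8
  -- This is where the subexponential delay is used.
  have h9 : Real.logb 2 d ≤ (η / 4) * n := (div_le_iff₀ hnpos).1 (hlog.trans hε2)
  linarith

theorem Achieves.le_relEntropy {P₀ P₁ : PMF 𝒴} (hfin : ∀ y, P₀ y = 0 → P₁ y = 0) {α : ℝ}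
    (hα : 0 ≤ α) {ρ : ℕ → ℝ} {D : ∀ n : ℕ, Detector 𝒴 (level α n + n - 1)} {ε : ℕ → ℝ}
    (h : Achieves P₀ P₁ α ρ D ε) : α ≤ relEntropy P₁ P₀ := by
  refine le_of_forall_pos_le_add fun η hη => ?_
  obtain ⟨n, hn, hn1⟩ := ((h.eventually_le hfin hα hη).and (eventually_ge_atTop 1)).exists
  have hnpos : (0 : ℝ) < n := by exact_mod_cast hn1
  have hD := relEntropy_nonneg P₀ P₁ hfin
  refine le_of_mul_le_mul_right (hn.trans ?_) hnpos
  have : ((min n (delay P₀ P₁ (level α n) n (D n) (ε n)) : ℕ) : ℝ) ≤ n := by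
    exact_mod_cast min_le_left _ _
  nlinarith

theorem Achieves.one_le_liminf {P₀ P₁ : PMF 𝒴} (hfin : ∀ y, P₀ y = 0 → P₁ y = 0) {α : ℝ}
    (hα : 0 < α) (hαD : α < relEntropy P₁ P₀) {ρ : ℕ → ℝ}
    {D : ∀ n : ℕ, Detector 𝒴 (level α n + n - 1)} {ε : ℕ → ℝ} (h : Achieves P₀ P₁ α ρ D ε) :
    1 ≤ liminf (fun n : ℕ => (((delay P₀ P₁ (level α n) n (D n) (ε n) : ℝ) /
      minDelay P₀ P₁ α n : ℝ) : EReal)) atTop := by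
  have hD : 0 < relEntropy P₁ P₀ := hα.trans hαD
  refine EReal.ge_of_forall_gt_iff_ge.1 fun c hc => ?_
  have hc1 : c < 1 := by exact_mod_cast hc
  refine le_liminf_of_le (by isBoundedDefault) ?_
  filter_upwards [h.eventually_le hfin hα.le (η := (1 - c) * α) (by nlinarith),
    eventually_ge_atTop 1] with n hn hn1
  have hnpos : (0 : ℝ) < n := by exact_mod_cast hn1
  have hmin : ((min n (delay P₀ P₁ (level α n) n (D n) (ε n)) : ℕ) : ℝ) ≤
      delay P₀ P₁ (level α n) n (D n) (ε n) := by
    exact_mod_cast min_le_right _ _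
  rw [EReal.coe_le_coe_iff, minDelay, le_div_iff₀ (by positivity), ← mul_div_assoc,
    div_le_iff₀ hD]
  nlinarith

end ConverseAsymptotics

/-! ### Typical windows -/

theorem one_sub_le_measureReal_of_not_le {Ω : Type*} [MeasurableSpace Ω] {μ : Measure Ω}
    [IsProbabilityMeasure μ] {p : Ω → Prop} {δ : ℝ} (h : μ.real {x | ¬ p x} ≤ δ) :
    1 - δ ≤ μ.real {x | p x} := by
  have h1 := measureReal_union_le (μ := μ) {x | p x} {x | ¬ p x}
  rw [show {x | p x} ∪ {x | ¬ p x} = Set.univ from Set.eq_univ_of_forall fun x => em _,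
    probReal_univ] at h1
  linarith

section Typicality

variable {𝒴 : Type*} [Fintype 𝒴]

/-- The times of the window of length `k` that ends at time `t`. -/
def window (N k t : ℕ) : Finset (Times N) :=
  Finset.univ.filter fun s : Times N => t + 1 - k ≤ (s : ℕ) ∧ (s : ℕ) < t + 1 - k + k

theorem card_window_eq {N k t : ℕ} (hk : k ≤ t) (ht : t ≤ N) : (window N k t).card = k :=
  card_window (by omega) (by omega)

open Classical in
omit [Fintype 𝒴] in
theorem empirical_eq_sum {N k t : ℕ} (hk : k ≤ t) (y : Times N → 𝒴) (a : 𝒴) :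
    empirical k t y a = (∑ s ∈ window N k t, if y s = a then (1 : ℝ) else 0) / k := by
  rw [Finset.sum_boole, empirical, window, Finset.filter_filter]
  congr 3
  ext s
  simp only [Finset.mem_filter, Finset.mem_univ, true_and]
  constructor
  · rintro ⟨h1, h2, h3⟩
    exact ⟨⟨by omega, by omega⟩, h3⟩
  · rintro ⟨⟨h1, h2⟩, h3⟩
    exact ⟨by omega, by omega, h3⟩

theorem sum_window_eq {N k t : ℕ} (hk0 : 0 < k) (hk : k ≤ t) (y : Times N → 𝒴) (f : 𝒴 → ℝ) :
    ∑ s ∈ window N k t, f (y s) = k * ∑ a, empirical k t y a * f a := by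
  classical
  have hk' : (k : ℝ) ≠ 0 := by exact_mod_cast hk0.ne'
  simp_rw [empirical_eq_sum hk, Finset.mul_sum, div_mul_eq_mul_div, mul_div_cancel₀ _ hk',
    Finset.sum_mul]
  rw [Finset.sum_comm]
  simp

theorem natCast_mul_rpow_neg_third {k : ℕ} (hk : 0 < k) :
    (k : ℝ) * (k : ℝ) ^ (-(1 / 3) : ℝ) = (k : ℝ) ^ (2 / 3 : ℝ) := by
  have hk' : (0 : ℝ) < k := by exact_mod_cast hk
  nth_rewrite 1 [← Real.rpow_one (k : ℝ)]
  rw [← Real.rpow_add hk']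
  norm_num

/-- A sum over a typical window is close to `k` times the expectation. -/
theorem TypicalAt.le_sum_window {P : PMF 𝒴} {N k t : ℕ} (hk0 : 0 < k) {y : Times N → 𝒴}
    (h : TypicalAt P k t y) {f : 𝒴 → ℝ} {M : ℝ} (hf : ∀ a, |f a| ≤ M) :
    k * (∑ a, (P a).toReal * f a) - (k : ℝ) ^ (2 / 3 : ℝ) * M ≤ ∑ s ∈ window N k t, f (y s) := by
  rw [sum_window_eq hk0 h.1, ← natCast_mul_rpow_neg_third hk0, mul_assoc, ← mul_sub]
  have hM : 0 ≤ M := by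
    obtain ⟨a, -⟩ := P.support_nonempty
    exact (abs_nonneg _).trans (hf a)
  refine mul_le_mul_of_nonneg_left ?_ (by positivity)
  have : ∑ a, (P a).toReal * f a - ∑ a, empirical k t y a * f a ≤
      ∑ a, |empirical k t y a - (P a).toReal| * M := by
    rw [← Finset.sum_sub_distrib]
    refine Finset.sum_le_sum fun a _ => ?_
    calc (P a).toReal * f a - empirical k t y a * f a
        = -((empirical k t y a - (P a).toReal) * f a) := by ring
      _ ≤ |(empirical k t y a - (P a).toReal) * f a| := neg_le_abs _
      _ ≤ _ := by rw [abs_mul]; gcongr; exact hf a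
  rw [← Finset.sum_mul] at this
  have := mul_le_mul_of_nonneg_right h.2 hM
  linarith

theorem typicalityTime_le {P : PMF 𝒴} {k N t : ℕ} {y : Times N → 𝒴} (h1 : 1 ≤ t) (h2 : t ≤ N)
    (h : TypicalAt P k t y) : typicalityTime P k N y ≤ t :=
  Nat.sInf_le (Or.inl ⟨h1, h2, h⟩)

/-- The likelihood ratio `P₁ / P₀`, with the value `1 / k` outside the support of `P₁`. A window of
length `k` that is typical for `P₁` may contain `k^{2/3}` letters outside this support, where
the likelihood ratio vanishes. -/
noncomputable def truncRatio (P₀ P₁ : PMF 𝒴) (k : ℕ) (a : 𝒴) : ℝ :=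
  open Classical in if P₁ a = 0 then (k : ℝ)⁻¹ else (P₁ a).toReal / (P₀ a).toReal

omit [Fintype 𝒴] in
theorem truncRatio_pos {P₀ P₁ : PMF 𝒴} (hfin : ∀ y, P₀ y = 0 → P₁ y = 0) {k : ℕ} (hk : 0 < k)
    (a : 𝒴) : 0 < truncRatio P₀ P₁ k a := by
  unfold truncRatio
  split_ifs with h
  · positivity
  · exact div_pos (ENNReal.toReal_pos h (P₁.apply_ne_top a))
      (ENNReal.toReal_pos (fun h0 => h (hfin a h0)) (P₀.apply_ne_top a))

theorem sum_mul_truncRatio_pow_le (P₀ P₁ : PMF 𝒴) {k : ℕ} (hk : 0 < k) :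
    (∑ a, (P₀ a).toReal * truncRatio P₀ P₁ k a) ^ k ≤ Real.exp 1 := by
  have hk' : (0 : ℝ) < k := by exact_mod_cast hk
  have h1 : ∑ a, (P₀ a).toReal * truncRatio P₀ P₁ k a ≤ 1 + (k : ℝ)⁻¹ := by
    calc _ ≤ ∑ a, ((P₁ a).toReal + (P₀ a).toReal * (k : ℝ)⁻¹) := by
          refine Finset.sum_le_sum fun a _ => ?_
          unfold truncRatio
          split_ifs with h
          · simp
          · have : (P₀ a).toReal * ((P₁ a).toReal / (P₀ a).toReal) ≤ (P₁ a).toReal := by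
              rcases eq_or_ne (P₀ a).toReal 0 with h0 | h0
              · simp [h0]
              · rw [mul_div_cancel₀ _ h0]
            have : 0 ≤ (P₀ a).toReal * (k : ℝ)⁻¹ := by positivity
            linarith
      _ = _ := by rw [Finset.sum_add_distrib, ← Finset.sum_mul, sum_toReal_pmf, sum_toReal_pmf,
                    one_mul]
  calc _ ≤ (1 + (k : ℝ)⁻¹) ^ k := by
        refine pow_le_pow_left₀ (Finset.sum_nonneg fun a _ => ?_) h1 k
        unfold truncRatio
        split_ifs <;> positivity
    _ ≤ Real.exp ((k : ℝ)⁻¹) ^ k := by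
        gcongr; rw [add_comm]; exact Real.add_one_le_exp _
    _ = Real.exp 1 := by rw [← Real.exp_nat_mul, mul_inv_cancel₀ hk'.ne']

theorem sum_mul_logb_truncRatio (P₀ P₁ : PMF 𝒴) (k : ℕ) :
    ∑ a, (P₁ a).toReal * Real.logb 2 (truncRatio P₀ P₁ k a) = relEntropy P₁ P₀ := by
  refine Finset.sum_congr rfl fun a _ => ?_
  unfold truncRatio
  split_ifs with h
  · simp [h]
  · rfl

/-- A bound for the log-likelihood ratio on the alphabet. -/
noncomputable def llrBound (P Q : PMF 𝒴) : ℝ :=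
  ∑ y, |Real.logb 2 ((P y).toReal / (Q y).toReal)|

theorem llrBound_nonneg (P Q : PMF 𝒴) : 0 ≤ llrBound P Q :=
  Finset.sum_nonneg fun _ _ => abs_nonneg _

theorem abs_logb_truncRatio_le (P₀ P₁ : PMF 𝒴) {k : ℕ} (hk : 0 < k) (a : 𝒴) :
    |Real.logb 2 (truncRatio P₀ P₁ k a)| ≤ llrBound P₁ P₀ + Real.logb 2 k := by
  have hlog : 0 ≤ Real.logb 2 k := Real.logb_nonneg (by norm_num) (by exact_mod_cast hk)
  unfold truncRatio
  split_ifs with h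
  · rw [Real.logb_inv, abs_neg, abs_of_nonneg hlog]
    linarith [llrBound_nonneg P₁ P₀]
  · have := Finset.single_le_sum (f := fun y => |Real.logb 2 ((P₁ y).toReal / (P₀ y).toReal)|)
      (fun _ _ => abs_nonneg _) (Finset.mem_univ a)
    unfold llrBound
    linarith

variable [MeasurableSpace 𝒴] [MeasurableSingletonClass 𝒴]

/-- A window that contains no observation with law `P₁` is typical for `P₁` with probability
`2^{-k D(P₁ ‖ P₀) + o(k)}`. -/
theorem obsLaw_typicalAt_le {P₀ P₁ : PMF 𝒴} (hfin : ∀ y, P₀ y = 0 → P₁ y = 0)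
    {n ν N k t : ℕ} (hk : 0 < k) (ht : t ≤ N) (htν : t < ν) :
    (obsLaw P₀ P₁ n ν N).real {y | TypicalAt P₁ k t y} ≤ Real.exp 1 / 2 ^ (k * relEntropy P₁ P₀ -
      (k : ℝ) ^ (2 / 3 : ℝ) * (llrBound P₁ P₀ + Real.logb 2 k)) := by
  rcases lt_or_ge t k with hkt | hkt
  · rw [show {y : Times N → 𝒴 | TypicalAt P₁ k t y} = ∅ from
      Set.eq_empty_of_forall_notMem fun y hy => absurd hy.1 (by omega), measureReal_empty]
    positivity
  have h := pi_toMeasure_chernoff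
    (fun s : Times N => if ν ≤ (s : ℕ) ∧ (s : ℕ) < ν + n then P₁ else P₀) (window N k t) P₀
    (fun s hs => if_neg (by simp only [window, Finset.mem_filter] at hs; omega))
    (truncRatio P₀ P₁ k) (truncRatio_pos hfin hk)
    (k * relEntropy P₁ P₀ - (k : ℝ) ^ (2 / 3 : ℝ) * (llrBound P₁ P₀ + Real.logb 2 k))
  rw [card_window_eq hkt ht] at h
  refine ((measureReal_mono fun y hy => ?_).trans h).trans ?_
  · have := TypicalAt.le_sum_window hk hy (abs_logb_truncRatio_le P₀ P₁ hk)
    rwa [sum_mul_logb_truncRatio] at this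
  · gcongr
    exact sum_mul_truncRatio_pow_le P₀ P₁ hk

/-- A window in which all observations have law `P₁` is typical for `P₁` with high probability. -/
theorem obsLaw_not_typicalAt_le (P₀ P₁ : PMF 𝒴) {n ν N k t : ℕ} (hk : 0 < k) (hkt : k ≤ t)
    (ht : t ≤ N) (hν : ν + k ≤ t + 1) (hn : t < ν + n) :
    (obsLaw P₀ P₁ n ν N).real {y | ¬ TypicalAt P₁ k t y} ≤
      (Fintype.card 𝒴 : ℝ) ^ 3 * (k : ℝ) ^ (-(1 / 3) : ℝ) := by
  classical
  have hk' : (0 : ℝ) < k := by exact_mod_cast hk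
  have : Nonempty 𝒴 := P₁.support_nonempty.to_type
  set q : ℝ := (Fintype.card 𝒴 : ℝ) with hq
  have hq0 : 0 < q := by simp [hq, Fintype.card_pos]
  set r : ℝ := (k : ℝ) ^ (-(1 / 3) : ℝ) with hr
  have hr0 : 0 < r := by positivity
  have hr3 : k * r ^ 3 = 1 := by
    rw [hr, ← Real.rpow_natCast, ← Real.rpow_mul hk'.le]
    norm_num
    rw [Real.rpow_neg_one, mul_inv_cancel₀ hk'.ne']
  have hc : 0 < k * r / q := by positivity
  have key : ∀ a, (obsLaw P₀ P₁ n ν N).real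
      {y | k * r / q ≤ |∑ s ∈ window N k t, (if y s = a then (1 : ℝ) else 0) -
        k * (P₁ a).toReal|} ≤ q ^ 2 * r := by
    intro a
    have h := pi_toMeasure_chebyshev
      (fun s : Times N => if ν ≤ (s : ℕ) ∧ (s : ℕ) < ν + n then P₁ else P₀) (window N k t) P₁
      (fun s hs => if_pos (by simp only [window, Finset.mem_filter] at hs; omega))
      (fun b => if b = a then 1 else 0) hc
    rw [card_window_eq hkt ht] at h
    simp only [mul_ite, mul_one, mul_zero, Finset.sum_ite_eq', Finset.mem_univ, if_true, ite_pow,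
      one_pow, ne_eq, OfNat.ofNat_ne_zero, not_false_eq_true, zero_pow] at h
    refine h.trans ?_
    have hP : (P₁ a).toReal ≤ 1 := ENNReal.toReal_mono ENNReal.one_ne_top (P₁.coe_le_one a)
    calc (k : ℝ) * (P₁ a).toReal / (k * r / q) ^ 2 ≤ k * 1 / (k * r / q) ^ 2 := by gcongr
      _ = q ^ 2 * r * (1 / (k * r ^ 3)) := by field_simp
      _ = q ^ 2 * r := by rw [hr3]; ring
  calc _ ≤ (obsLaw P₀ P₁ n ν N).real (⋃ a, {y | k * r / q ≤
        |∑ s ∈ window N k t, (if y s = a then (1 : ℝ) else 0) - k * (P₁ a).toReal|}) := by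
        refine measureReal_mono fun y hy => ?_
        by_contra hy'
        simp only [Set.mem_iUnion, Set.mem_ofPred_eq, not_exists, not_le] at hy'
        refine hy ⟨hkt, ?_⟩
        calc _ ≤ ∑ a : 𝒴, r / q := by
              refine Finset.sum_le_sum fun a _ => ?_
              rw [empirical_eq_sum hkt]
              have h1 := (hy' a).le
              rw [← mul_le_mul_iff_right₀ hk']
              calc _ = |∑ s ∈ window N k t, (if y s = a then (1 : ℝ) else 0) -
                    k * (P₁ a).toReal| := by
                    nth_rewrite 1 [← abs_of_pos hk']
                    rw [← abs_mul, mul_sub, mul_div_cancel₀ _ hk'.ne']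
                _ ≤ k * (r / q) := by rw [← mul_div_assoc]; exact h1
          _ = r := by
              rw [Finset.sum_const, Finset.card_univ, nsmul_eq_mul]
              exact mul_div_cancel₀ _ hq0.ne'
    _ ≤ ∑ a : 𝒴, q ^ 2 * r := (measureReal_iUnion_fintype_le _).trans
        (Finset.sum_le_sum fun a _ => key a)
    _ = q ^ 3 * r := by
        rw [Finset.sum_const, Finset.card_univ, nsmul_eq_mul]
        ring

/-- The test is not randomized, so that probabilities under the joint law reduce to probabilities
under the laws of the observations. -/
theorem jointLaw_typicalityTest_le (P₀ P₁ P : PMF 𝒴) {A : ℕ} (hA : 0 < A) (n k : ℕ)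
    (p : ℕ → ℕ → Prop) {δ : ℝ} (h : ∀ ν ∈ Finset.Icc 1 A, (obsLaw P₀ P₁ n ν (A + n - 1)).real
      {y | p ν (typicalityTime P k (A + n - 1) y)} ≤ δ) :
    (jointLaw P₀ P₁ A n (typicalityTest P k (A + n - 1))).real
      {x | p x.1 ((typicalityTest P k (A + n - 1)).stopTime x.2.2 x.2.1)} ≤ δ := by
  rw [jointLaw_real_eq]
  have hA' : (0 : ℝ) < A := by exact_mod_cast hA
  calc _ ≤ (A : ℝ)⁻¹ * ∑ ν ∈ Finset.Icc 1 A, δ := by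
        gcongr with ν hν
        refine le_trans (le_of_eq ?_) (h ν hν)
        exact (measurePreserving_fst (μ := obsLaw P₀ P₁ n ν (A + n - 1))
          (ν := (typicalityTest P k (A + n - 1)).seedLaw)).measureReal_preimage
            (Set.toFinite
              {y | p ν (typicalityTime P k (A + n - 1) y)}).measurableSet.nullMeasurableSet
    _ = δ := by
        rw [Finset.sum_const, Nat.card_Icc, nsmul_eq_mul]
        simp [hA'.ne']

/-- The union bound over the at most `A` windows that end before the change. -/
theorem falseAlarm_typicalityTest_le {P₀ P₁ : PMF 𝒴} (hfin : ∀ y, P₀ y = 0 → P₁ y = 0) {A n k : ℕ}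
    (hA : 0 < A) (hn : 0 < n) (hk : 0 < k) :
    falseAlarm P₀ P₁ A n (typicalityTest P₁ k (A + n - 1)) ≤
      A * (Real.exp 1 / 2 ^ (k * relEntropy P₁ P₀ -
        (k : ℝ) ^ (2 / 3 : ℝ) * (llrBound P₁ P₀ + Real.logb 2 k))) := by
  refine jointLaw_typicalityTest_le P₀ P₁ P₁ hA n k (fun ν t => t < ν) fun ν hν => ?_
  rw [Finset.mem_Icc] at hν
  calc _ ≤ (obsLaw P₀ P₁ n ν (A + n - 1)).real
        (⋃ t ∈ Finset.range ν, {y | TypicalAt P₁ k t y}) := by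
        refine measureReal_mono (fun y hy => ?_) (measure_ne_top _ _)
        simp only [Set.mem_ofPred_eq] at hy
        rcases typicalityTime_mem P₁ k (A + n - 1) y with ⟨-, -, h⟩ | h
        · simp only [Set.mem_iUnion, Finset.mem_range, Set.mem_ofPred_eq]
          exact ⟨_, hy, h⟩
        -- Stopping at the end `A + n - 1 ≥ ν` of the horizon is not a false alarm.
        · omega
    _ ≤ ∑ t ∈ Finset.range ν, Real.exp 1 / 2 ^ (k * relEntropy P₁ P₀ -
        (k : ℝ) ^ (2 / 3 : ℝ) * (llrBound P₁ P₀ + Real.logb 2 k)) := by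
        refine (measureReal_biUnion_finset_le _ _).trans (Finset.sum_le_sum fun t ht => ?_)
        rw [Finset.mem_range] at ht
        exact obsLaw_typicalAt_le hfin hk (by omega) ht
    _ ≤ _ := by
        rw [Finset.sum_const, Finset.card_range, nsmul_eq_mul]
        gcongr
        exact hν.2

/-- The test has stopped by time `ν + k - 1` unless the first window inside the changed segment
fails to be typical. -/
theorem one_sub_le_typicalityTest_delay (P₀ P₁ : PMF 𝒴) {A n k : ℕ} (hA : 0 < A) (hk : 0 < k)
    (hkn : k ≤ n) :
    1 - (Fintype.card 𝒴 : ℝ) ^ 3 * (k : ℝ) ^ (-(1 / 3) : ℝ) ≤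
      (jointLaw P₀ P₁ A n (typicalityTest P₁ k (A + n - 1))).real
        {x | ((typicalityTest P₁ k (A + n - 1)).stopTime x.2.2 x.2.1 : ℤ) - (x.1 : ℤ) ≤
          (k : ℤ) - 1} := by
  have := jointLaw_isProbabilityMeasure P₀ P₁ hA n (typicalityTest P₁ k (A + n - 1))
  have h := jointLaw_typicalityTest_le P₀ P₁ P₁ hA n k
    (fun ν t => ¬ (t : ℤ) - (ν : ℤ) ≤ (k : ℤ) - 1)
    (δ := (Fintype.card 𝒴 : ℝ) ^ 3 * (k : ℝ) ^ (-(1 / 3) : ℝ)) fun ν hν => by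
      rw [Finset.mem_Icc] at hν
      refine (measureReal_mono fun y hy => ?_).trans (obsLaw_not_typicalAt_le P₀ P₁
        (n := n) (ν := ν) (t := ν + k - 1) hk (by omega) (by omega) (by omega) (by omega))
      intro hty
      have := typicalityTime_le (by omega) (by omega) hty
      simp only [Set.mem_ofPred_eq] at hy
      omega
  exact one_sub_le_measureReal_of_not_le h

omit [Fintype 𝒴] [MeasurableSingletonClass 𝒴] in
theorem delay_le {P₀ P₁ : PMF 𝒴} {A n l : ℕ} {D : Detector 𝒴 (A + n - 1)} {ε : ℝ}
    (h : 1 - ε ≤ (jointLaw P₀ P₁ A n D).real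
      {x | (D.stopTime x.2.2 x.2.1 : ℤ) - (x.1 : ℤ) ≤ (l : ℤ) - 1}) :
    delay P₀ P₁ A n D ε ≤ l :=
  Nat.sInf_le h

omit [MeasurableSpace 𝒴] [Fintype 𝒴] [MeasurableSingletonClass 𝒴] in
theorem Detector.numSamples_le {N : ℕ} (D : Detector 𝒴 N) (ω : D.Seed) (y : Times N → 𝒴) :
    D.numSamples ω y ≤ D.stopTime ω y := by
  unfold Detector.numSamples
  calc _ ≤ (Finset.Icc 1 (D.stopTime ω y)).card := by
        refine Finset.card_le_card_of_injOn (fun s => (s : ℕ)) (fun s hs => ?_)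
          fun _ _ _ _ h => Subtype.ext h
        simp only [Finset.coe_filter, Set.mem_ofPred_eq] at hs
        simpa using ⟨(Finset.mem_Icc.1 s.2).1, hs.2⟩
    _ = _ := by simp

omit [Fintype 𝒴] [MeasurableSingletonClass 𝒴] in
theorem samplingRate_le_one (P₀ P₁ : PMF 𝒴) {A : ℕ} (hA : 0 < A) (n : ℕ)
    (D : Detector 𝒴 (A + n - 1)) {ε : ℝ} (hε : 0 ≤ ε) : samplingRate P₀ P₁ A n D ε ≤ 1 := by
  have := jointLaw_isProbabilityMeasure P₀ P₁ hA n D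
  refine csInf_le ⟨0, fun r hr => hr.1⟩ ⟨zero_le_one, ?_⟩
  rw [show {x : ℕ × (Times (A + n - 1) → 𝒴) × D.Seed |
      (D.numSamples x.2.2 x.2.1 : ℝ) / (D.stopTime x.2.2 x.2.1 : ℝ) ≤ 1} = Set.univ from
      Set.eq_univ_of_forall fun x =>
        Set.mem_ofPred.2 (div_le_one_of_le₀ (Nat.cast_le.2 (D.numSamples_le x.2.2 x.2.1))
          (Nat.cast_nonneg _)),
    probReal_univ]
  linarith

end Typicality

/-! ### The window length -/

section WindowLength

/-- The window length `α n / d + n^{3/4}`, rounded up, for a divergence `d`. The first term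
is `n^*(α)`; the second is negligible compared to it, but exceeds the loss of order
`n^{2/3} log n` in the exponent of `obsLaw_typicalAt_le`. -/
noncomputable def windowLength (d α : ℝ) (n : ℕ) : ℕ := ⌈α * n / d + (n : ℝ) ^ (3 / 4 : ℝ)⌉₊

variable {d α : ℝ}

theorem le_windowLength (d α : ℝ) (n : ℕ) :
    α * n / d + (n : ℝ) ^ (3 / 4 : ℝ) ≤ windowLength d α n := Nat.le_ceil _

theorem windowLength_pos (hd : 0 < d) (hα : 0 < α) {n : ℕ} (hn : 0 < n) :
    0 < windowLength d α n := by
  have hn' : (0 : ℝ) < n := by exact_mod_cast hn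
  exact Nat.ceil_pos.2 (by positivity)

theorem tendsto_windowLength_div (hd : 0 < d) (hα : 0 < α) :
    Tendsto (fun n : ℕ => (windowLength d α n : ℝ) / n) atTop (𝓝 (α / d)) := by
  have h1 : Tendsto (fun n : ℕ => (n : ℝ) ^ (-(1 / 4) : ℝ)) atTop (𝓝 0) :=
    (tendsto_rpow_neg_atTop (by norm_num)).comp tendsto_natCast_atTop_atTop
  have h2 : Tendsto (fun n : ℕ => (1 : ℝ) / n) atTop (𝓝 0) :=
    tendsto_const_div_atTop_nhds_zero_nat 1
  have h3 : Tendsto (fun n : ℕ => α / d + (n : ℝ) ^ (-(1 / 4) : ℝ) + 1 / n) atTop (𝓝 (α / d)) := by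
    simpa using (tendsto_const_nhds.add h1).add h2
  refine tendsto_of_tendsto_of_tendsto_of_le_of_le' tendsto_const_nhds h3 ?_ ?_ <;>
    filter_upwards [eventually_gt_atTop 0] with n hn
  · have hn' : (0 : ℝ) < n := by exact_mod_cast hn
    rw [le_div_iff₀ hn']
    refine le_trans ?_ (le_windowLength d α n)
    have : 0 ≤ (n : ℝ) ^ (3 / 4 : ℝ) := by positivity
    linarith [show α / d * n = α * n / d by ring]
  · have hn' : (0 : ℝ) < n := by exact_mod_cast hn
    rw [div_le_iff₀ hn']
    refine (Nat.ceil_lt_add_one (by positivity)).le.trans (le_of_eq ?_)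
    have : (n : ℝ) ^ (3 / 4 : ℝ) = (n : ℝ) ^ (-(1 / 4) : ℝ) * n := by
      rw [← Real.rpow_add_one hn'.ne']; norm_num
    rw [this]
    field_simp

theorem eventually_windowLength_le (hd : 0 < d) (hα : 0 < α) (hαd : α < d) :
    ∀ᶠ n : ℕ in atTop, windowLength d α n ≤ n := by
  filter_upwards [(tendsto_windowLength_div hd hα).eventually_le_const ((div_lt_one hd).2 hαd),
    eventually_gt_atTop 0] with n h hn
  rw [div_le_one (by exact_mod_cast hn)] at h
  exact_mod_cast h

theorem tendsto_windowLength_atTop (hd : 0 < d) (hα : 0 < α) :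
    Tendsto (fun n : ℕ => (windowLength d α n : ℝ)) atTop atTop := by
  refine tendsto_atTop_mono (fun n => ?_)
    (tendsto_natCast_atTop_atTop.const_mul_atTop (div_pos hα hd))
  refine le_trans ?_ (le_windowLength d α n)
  have : 0 ≤ (n : ℝ) ^ (3 / 4 : ℝ) := by positivity
  linarith [show α / d * n = α * n / d by ring]

theorem eventually_add_logb_le (C : ℝ) {c : ℝ} (hc : 0 < c) :
    ∀ᶠ n : ℕ in atTop, C + Real.logb 2 n ≤ c * (n : ℝ) ^ (1 / 12 : ℝ) := by
  have h1 : ∀ᶠ x : ℝ in atTop, C ≤ c / 2 * x ^ (1 / 12 : ℝ) :=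
    ((tendsto_rpow_atTop (by norm_num)).const_mul_atTop (by positivity)).eventually_ge_atTop C
  have h2 := (isLittleO_log_rpow_atTop (show (0 : ℝ) < 1 / 12 by norm_num)).bound
    (show 0 < c / 2 * Real.log 2 by have := Real.log_pos one_lt_two; positivity)
  filter_upwards [tendsto_natCast_atTop_atTop.eventually h1,
    tendsto_natCast_atTop_atTop.eventually h2] with n h1 h2
  have hlog : 0 < Real.log 2 := Real.log_pos one_lt_two
  have h3 : Real.logb 2 n ≤ c / 2 * (n : ℝ) ^ (1 / 12 : ℝ) := by
    rw [Real.logb, div_le_iff₀ hlog]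
    have h4 : ‖(n : ℝ) ^ (1 / 12 : ℝ)‖ = (n : ℝ) ^ (1 / 12 : ℝ) :=
      Real.norm_of_nonneg (by positivity)
    rw [h4] at h2
    calc _ ≤ _ := (Real.le_norm_self _).trans h2
      _ = _ := by ring
  linarith

/-- With the window length `windowLength d α`, the union bound over `2^{α n}` windows
leaves an exponent that tends to infinity. -/
theorem eventually_windowLength_exponent (hd : 0 < d) (hα : 0 < α) (hαd : α < d) {C : ℝ}
    (hC : 0 ≤ C) : ∀ᶠ n : ℕ in atTop, α * n + d / 2 * (n : ℝ) ^ (3 / 4 : ℝ) ≤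
      windowLength d α n * d -
        (windowLength d α n : ℝ) ^ (2 / 3 : ℝ) * (C + Real.logb 2 (windowLength d α n)) := by
  filter_upwards [eventually_windowLength_le hd hα hαd, eventually_gt_atTop 0,
    eventually_add_logb_le C (half_pos hd)] with n hkn hn hlog
  have hn' : (0 : ℝ) < n := by exact_mod_cast hn
  have hk1 : (1 : ℝ) ≤ windowLength d α n := by exact_mod_cast windowLength_pos hd hα hn
  have hkn' : (windowLength d α n : ℝ) ≤ n := by exact_mod_cast hkn
  have h1 : α * n + d * (n : ℝ) ^ (3 / 4 : ℝ) ≤ windowLength d α n * d := by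
    calc _ = (α * n / d + (n : ℝ) ^ (3 / 4 : ℝ)) * d := by field_simp
      _ ≤ _ := by gcongr; exact le_windowLength d α n
  have h2 : (windowLength d α n : ℝ) ^ (2 / 3 : ℝ) * (C + Real.logb 2 (windowLength d α n)) ≤
      d / 2 * (n : ℝ) ^ (3 / 4 : ℝ) := by
    have h3 : Real.logb 2 (windowLength d α n) ≤ Real.logb 2 n :=
      Real.logb_le_logb_of_le (by norm_num) (by linarith) hkn'
    have h4 : 0 ≤ Real.logb 2 (windowLength d α n) := Real.logb_nonneg (by norm_num) hk1
    calc _ ≤ (n : ℝ) ^ (2 / 3 : ℝ) * (d / 2 * (n : ℝ) ^ (1 / 12 : ℝ)) := by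
          gcongr
          linarith
      _ = d / 2 * ((n : ℝ) ^ (2 / 3 : ℝ) * (n : ℝ) ^ (1 / 12 : ℝ)) := by ring
      _ = _ := by rw [← Real.rpow_add hn']; norm_num
  linarith

end WindowLength

/-! ### Achievability -/

section Achievability

variable {𝒴 : Type*} [Fintype 𝒴] [MeasurableSpace 𝒴] [MeasurableSingletonClass 𝒴]

theorem tendsto_falseAlarm_typicalityTest {P₀ P₁ : PMF 𝒴} (hfin : ∀ y, P₀ y = 0 → P₁ y = 0)
    {α : ℝ} (hα : 0 < α) (hαD : α < relEntropy P₁ P₀) :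
    Tendsto (fun n : ℕ => falseAlarm P₀ P₁ (level α n) n
      (typicalityTest P₁ (windowLength (relEntropy P₁ P₀) α n) (level α n + n - 1)))
      atTop (𝓝 0) := by
  have hD := hα.trans hαD
  have hexp : Tendsto (fun n : ℕ => Real.exp 1 *
      (2 : ℝ) ^ (-(relEntropy P₁ P₀ / 2 * (n : ℝ) ^ (3 / 4 : ℝ)))) atTop (𝓝 0) := by
    have h1 : Tendsto (fun n : ℕ => relEntropy P₁ P₀ / 2 * (n : ℝ) ^ (3 / 4 : ℝ)) atTop atTop :=
      ((tendsto_rpow_atTop (by norm_num)).comp tendsto_natCast_atTop_atTop).const_mul_atTop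
        (half_pos hD)
    simpa using ((tendsto_rpow_atBot_of_base_gt_one 2 one_lt_two).comp
      (tendsto_neg_atTop_atBot.comp h1)).const_mul (Real.exp 1)
  refine squeeze_zero' (.of_forall fun n => measureReal_nonneg) ?_ hexp
  filter_upwards [eventually_windowLength_exponent hD hα hαD (llrBound_nonneg P₁ P₀),
    eventually_gt_atTop 0] with n hb hn
  refine (falseAlarm_typicalityTest_le hfin (level_pos hα.le n) hn
    (windowLength_pos hD hα hn)).trans ?_
  calc _ ≤ (2 : ℝ) ^ (α * n) * (Real.exp 1 /
        2 ^ (α * n + relEntropy P₁ P₀ / 2 * (n : ℝ) ^ (3 / 4 : ℝ))) := by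
        gcongr
        · exact Nat.floor_le (by positivity)
        · exact one_le_two
    _ = _ := by
        rw [Real.rpow_add two_pos, Real.rpow_neg two_pos.le]
        field_simp

/-- The sequential typicality test with windows of length `windowLength` achieves every exponent
below the divergence, with a delay of at most the window length. -/
theorem exists_achieves_typicalityTest {P₀ P₁ : PMF 𝒴} (hfin : ∀ y, P₀ y = 0 → P₁ y = 0)
    {α : ℝ} (hα : 0 < α) (hαD : α < relEntropy P₁ P₀) :
    ∃ ε : ℕ → ℝ,
      Achieves P₀ P₁ α (fun _ => 1) (fun n => typicalityTest P₁
        (windowLength (relEntropy P₁ P₀) α n) (level α n + n - 1)) ε ∧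
      ∀ᶠ n : ℕ in atTop, delay P₀ P₁ (level α n) n (typicalityTest P₁
        (windowLength (relEntropy P₁ P₀) α n) (level α n + n - 1)) (ε n) ≤
          windowLength (relEntropy P₁ P₀) α n := by
  have hD := hα.trans hαD
  set k := windowLength (relEntropy P₁ P₀) α with hk
  set fa : ℕ → ℝ := fun n => falseAlarm P₀ P₁ (level α n) n
    (typicalityTest P₁ (k n) (level α n + n - 1)) with hfa
  set miss : ℕ → ℝ := fun n => (Fintype.card 𝒴 : ℝ) ^ 3 * (k n : ℝ) ^ (-(1 / 3) : ℝ) with hmiss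
  set lg : ℕ → ℝ := fun n => Real.logb 2 n / n with hlg
  have hfa0 : ∀ n, 0 ≤ fa n := fun n => measureReal_nonneg
  have hmiss0 : ∀ n, 0 ≤ miss n := fun n => by positivity
  have hlg0 : ∀ n, 0 ≤ lg n := fun n => by
    rcases Nat.eq_zero_or_pos n with rfl | hn
    · simp [hlg]
    · exact div_nonneg (Real.logb_nonneg (by norm_num) (by exact_mod_cast hn)) (by positivity)
  have hmisslim : Tendsto miss atTop (𝓝 0) := by
    have h := ((tendsto_rpow_neg_atTop (y := 1 / 3) (by norm_num)).comp
      (tendsto_windowLength_atTop hD hα)).const_mul ((Fintype.card 𝒴 : ℝ) ^ 3)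
    rw [mul_zero] at h
    exact h
  have hlglim : Tendsto lg atTop (𝓝 0) := by
    have h := (Real.isLittleO_log_id_atTop.tendsto_div_nhds_zero.comp
      tendsto_natCast_atTop_atTop).div_const (Real.log 2)
    simp only [zero_div] at h
    refine h.congr fun n => ?_
    simp only [hlg, Real.logb, Function.comp_apply, id_eq]
    ring
  have hdelay : ∀ᶠ n : ℕ in atTop, delay P₀ P₁ (level α n) n
      (typicalityTest P₁ (k n) (level α n + n - 1)) (fa n + miss n + lg n) ≤ k n := by
    filter_upwards [eventually_windowLength_le hD hα hαD, eventually_gt_atTop 0] with n hkn hn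
    refine delay_le (le_trans ?_ (one_sub_le_typicalityTest_delay P₀ P₁ (level_pos hα.le n)
      (windowLength_pos hD hα hn) hkn))
    linarith [hfa0 n, hlg0 n, show miss n = (Fintype.card 𝒴 : ℝ) ^ 3 *
      (windowLength (relEntropy P₁ P₀) α n : ℝ) ^ (-(1 / 3) : ℝ) from rfl]
  -- The tolerance is the sum of the three quantities that it has to bound.
  refine ⟨fun n => fa n + miss n + lg n, ⟨fun n => ?_, ?_, ?_⟩, hdelay⟩
  · linarith [hfa0 n, hlg0 n, hmiss0 n]
  · simpa using ((tendsto_falseAlarm_typicalityTest hfin hα hαD).add hmisslim).add hlglim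
  · filter_upwards [hdelay, eventually_windowLength_le hD hα hαD, eventually_gt_atTop 0]
      with n hd hkn hn
    refine ⟨by linarith [hmiss0 n, hlg0 n], samplingRate_le_one P₀ P₁ (level_pos hα.le n) n _
      (by linarith [hfa0 n, hlg0 n, hmiss0 n]), ?_⟩
    refine le_trans ?_ (show lg n ≤ fa n + miss n + lg n by linarith [hfa0 n, hmiss0 n])
    refine div_le_div_of_nonneg_right ?_ (by positivity)
    have hdn := hd.trans hkn
    rcases Nat.eq_zero_or_pos (delay P₀ P₁ (level α n) n
      (typicalityTest P₁ (k n) (level α n + n - 1)) (fa n + miss n + lg n)) with h0 | h0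
    -- A zero delay has the conventional logarithm `0`.
    · rw [h0, Nat.cast_zero, Real.logb_zero]
      exact Real.logb_nonneg (by norm_num) (by exact_mod_cast hn)
    · exact Real.logb_le_logb_of_le (by norm_num) (by exact_mod_cast h0) (by exact_mod_cast hdn)

/-- The detector that samples at every time and stops at time `1` (the minimum with `N`
covers the empty horizon). -/
noncomputable def immediateDetector (𝒴 : Type*) (N : ℕ) : Detector 𝒴 N where
  Seed := Unit
  seedSpace := inferInstance
  seedLaw := Measure.dirac ()
  seedLaw_prob := inferInstance
  sample := fun _ _ => Finset.univ
  stopTime := fun _ _ => min 1 N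
  measurable_sample := fun _ _ => .of_discrete
  measurable_stop := fun _ _ => .of_discrete
  adaptive := fun _ _ _ _ _ => by simp
  nonanticipating := fun _ _ _ _ => rfl
  stop_pos := fun hN _ _ => by omega
  stop_le := fun _ _ => by omega

/-- At the exponent `0` the change point is known to be `1`. -/
theorem achievable_zero (P₀ P₁ : PMF 𝒴) : Achievable P₀ P₁ 0 fun _ => 1 := by
  have hlev : ∀ n, level 0 n = 1 := fun n => by simp [level]
  refine ⟨fun n => immediateDetector 𝒴 _, fun _ => 0, fun _ => le_rfl, tendsto_const_nhds, ?_⟩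
  filter_upwards [eventually_gt_atTop 0] with n hn
  have hprob := jointLaw_isProbabilityMeasure P₀ P₁ (level_pos le_rfl n) n (immediateDetector 𝒴 _)
  have hone : ∀ ω y, (immediateDetector 𝒴 (level 0 n + n - 1)).stopTime ω y = 1 := fun ω y => by
    have := hlev n
    simp only [immediateDetector]
    omega
  have hint := jointLaw_real_eq P₀ P₁ (level 0 n) n (immediateDetector 𝒴 _)
  refine ⟨?_, samplingRate_le_one P₀ P₁ (level_pos le_rfl n) n _ le_rfl, ?_⟩
  · rw [falseAlarm, hint fun ν t => t < ν]
    simp only [hone, hlev]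
    simp
  · have : delay P₀ P₁ (level 0 n) n (immediateDetector 𝒴 _) 0 ≤ 1 := by
      refine delay_le ?_
      rw [hint fun ν t => (t : ℤ) - (ν : ℤ) ≤ ((1 : ℕ) : ℤ) - 1]
      simp only [hone, hlev]
      simp
    have h0 : Real.logb 2 (delay P₀ P₁ (level 0 n) n (immediateDetector 𝒴 _) 0 : ℝ) = 0 := by
      interval_cases delay P₀ P₁ (level 0 n) n (immediateDetector 𝒴 _) 0 <;> simp
    rw [h0, zero_div]

end Achievability

end TransientChange

open TransientChange in
theorem theorem1 {𝒴 : Type*} [Fintype 𝒴] [MeasurableSpace 𝒴] [MeasurableSingletonClass 𝒴]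
    (P₀ P₁ : PMF 𝒴) (hfin : ∀ y, P₀ y = 0 → P₁ y = 0) :
    IsLUB {α : ℝ | 0 ≤ α ∧ Achievable P₀ P₁ α (fun _ => 1)} (relEntropy P₁ P₀) ∧
    (∀ α : ℝ, 0 < α → α < relEntropy P₁ P₀ →
      ∀ (D : ∀ n : ℕ, Detector 𝒴 (level α n + n - 1)) (ε : ℕ → ℝ),
        Achieves P₀ P₁ α (fun _ => 1) D ε →
        1 ≤ liminf (fun n : ℕ =>
          (((delay P₀ P₁ (level α n) n (D n) (ε n) : ℝ) / minDelay P₀ P₁ α n : ℝ) : EReal))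
          atTop) ∧
    (∀ α : ℝ, 0 < α → α < relEntropy P₁ P₀ →
      ∃ (k : ℕ → ℕ) (ε : ℕ → ℝ),
        Achieves P₀ P₁ α (fun _ => 1) (fun n => typicalityTest P₁ (k n) (level α n + n - 1)) ε ∧
        limsup (fun n : ℕ =>
          (((delay P₀ P₁ (level α n) n (typicalityTest P₁ (k n) (level α n + n - 1)) (ε n) : ℝ) /
            minDelay P₀ P₁ α n : ℝ) : EReal)) atTop ≤ 1) := by
  refine ⟨⟨?_, ?_⟩, ?_, ?_⟩
  · rintro α ⟨hα, D, ε, h⟩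
    exact h.le_relEntropy hfin hα
  · intro b hb
    refine le_of_forall_lt fun α hαD => ?_
    rcases lt_or_ge α 0 with hα | hα
    -- The exponent `0` is what is left when the divergence is zero.
    · exact hα.trans_le (hb ⟨le_rfl, achievable_zero P₀ P₁⟩)
    · obtain ⟨β, hαβ, hβD⟩ := exists_between hαD
      obtain ⟨ε, h, -⟩ := exists_achieves_typicalityTest hfin (hα.trans_lt hαβ) hβD
      exact hαβ.trans_le (hb ⟨hα.trans hαβ.le, _, ε, h⟩)
  · intro α hα hαD D ε h
    exact h.one_le_liminf hfin hα hαD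
  · intro α hα hαD
    have hD := hα.trans hαD
    obtain ⟨ε, h, hdelay⟩ := exists_achieves_typicalityTest hfin hα hαD
    refine ⟨_, ε, h, ?_⟩
    have hlim : Tendsto (fun n : ℕ => (((windowLength (relEntropy P₁ P₀) α n : ℝ) /
        minDelay P₀ P₁ α n : ℝ) : EReal)) atTop (𝓝 1) := by
      refine (continuous_coe_real_ereal.tendsto 1).comp ?_
      have := (tendsto_windowLength_div hD hα).div_const (α / relEntropy P₁ P₀)
      rw [div_self (by positivity)] at this
      refine this.congr fun n => ?_
      rw [minDelay, div_div, mul_div_assoc]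
    refine (limsup_le_limsup ?_).trans hlim.limsup_eq.le
    filter_upwards [hdelay] with n hn
    rw [EReal.coe_le_coe_iff]
    refine div_le_div_of_nonneg_right (by exact_mod_cast hn) ?_
    unfold minDelay
    positivity
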